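/- **Setting.** Let $\kappa$ be a security parameter. For each $\kappa$ let $q=q(\kappa)$ be a prime whose bit length is polynomially bounded in $\kappa$, let $g\in\mathbb Z_q^*$, and let $G=\langle g\rangle\le\mathbb Z_q^*$ (for instance $G=\mathbb Z_q^*$ if $g$ is a primitive root). Exponents are drawn uniformly from the residues modulo $|G|$; $\kappa,q,g,|G|$ are public and known to all parties. Fix a number $n$ of voters, a number $m$ of candidates and a number $\lambda$ of primes per candidate, and let $N=\lambda m$. "Indistinguishable" means that every probabilistic polynomial-time distinguisher has advantage negligible in $\kappa$. *Diffie–Hellman assumption in $G$:* for independent uniform exponents $a,b,c$, the triples $(g^a,g^b,g^{ab})$ and $(g^a,g^b,g^c)$ are indistinguishable. *Oblivious transfer.* Let $\mathrm{OT}^{N}_1$ be a two-party protocol with polynomial-time sender and receiver in which an honest receiver with choice $r$, interacting with an honest sender holding $N$ strings (numbers below $q$), obtains the $r$-th string up to negligible error. It has *receiver security* if, for all choices $r<r'$, no probabilistic polynomial-time sender (possibly deviating from the protocol) can distinguish interacting with an honest receiver with choice $r$ from interacting with one with choice $r'$. *Election.* Every voter $V_j$ has a uniform private exponent $d_j$ and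 publishes $g^{d_j}$; the joint public key is $e=\prod_{j=1}^n g^{d_j}$. By any probabilistic polynomial-time procedure, the distributor chooses distinct primes $p_1,\dots,p_N$ that lie in $G$ and satisfy $p_j^n<q$, and the distributor chooses a uniform mask exponent $s$. Voter $V_i$ selects an index $r_i$, runs $\mathrm{OT}^N_1$ with the distributor with choice $r_i$, and publishes $(g^{x_i},\,p_{r_i}g^se^{x_i})$ with a uniform exponent $x_i$; the second component is the ballot. **Theorem.** Assume that $\mathrm{OT}^{\lambda m}_1$ has receiver security and that the Diffie–Hellman assumption holds in $G$. Then for every $1\le i\le n$ the ballot $p_{r_i}g^se^{x_i}$ of $V_i$ is indistinguishable from a uniformly random element of $G$, even for an adversary who knows the public parameters, all public keys $g^{d_j}$, all private keys $d_j$ with $j\ne i$, the primes and any further information the distributor kept when choosing them, the mask exponent $s$ and $g^{x_i}$, and who plays (possibly maliciously) the sender in the oblivious transfer with $V_i$. More precisely, for all indices $r,r'\in\{1,\dots,\lambda m\}$, the experiment in which $V_i$ uses the choice $r_i=r$ in the oblivious transfer and publishes the ballot $p_{r}g^se^{x_i}$ is indistinguishable from the experiment in which $V_i$ uses the choice $r'$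 in the oblivious transfer and the ballot is replaced by an independent uniformly random element of $G$. -/

import Mathlib

open Filter Asymptotics

noncomputable section

/-! ### Probabilistic interactive programs with a bit-cost clock

Programs over finitely many registers that hold natural numbers in binary. Every instruction is
charged the bit lengths of the numbers it reads and writes, and is itself computable in
polynomial time on a Turing machine; conversely a Turing machine is simulated by keeping its tape
in registers. So "polynomial cost" below is probabilistic polynomial time. -/

/-- The contents of the registers. -/
abbrev Store := ℕ → ℕ

/-- The store whose first registers hold the given list, all others being `0`. -/
def Store.ofList (l : List ℕ) : Store := fun i => l.getD i 0

/-- Binary arithmetic operations (`sub` is truncated). -/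
inductive ArithOp
  | add | sub | mul | div | mod

def ArithOp.apply : ArithOp → ℕ → ℕ → ℕ
  | .add, a, b => a + b
  | .sub, a, b => a - b
  | .mul, a, b => a * b
  | .div, a, b => a / b
  | .mod, a, b => a % b

/-- Modular exponentiation. -/
def powModVal (a b c : ℕ) : ℕ := if c = 0 then 0 else a ^ b % c

/-- Programs; `d, a, b, c` are register numbers, except for the constant in `const d v`. -/
inductive Prog
  | skip
  /-- `d := v` -/
  | const (d v : ℕ)
  /-- `d := a op b` -/
  | arith (op : ArithOp) (d a b : ℕ)
  /-- `d := a ^ b mod c` -/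
  | powMod (d a b c : ℕ)
  /-- `d :=` a uniformly random number below the content of `a` -/
  | rand (d a : ℕ)
  /-- send the content of `a` to the communication partner and store the reply in `d` -/
  | call (d a : ℕ)
  | seq (P Q : Prog)
  /-- run `P` if register `a` is nonzero and `Q` otherwise -/
  | cond (a : ℕ) (P Q : Prog)
  /-- run `P` as long as register `a` is nonzero -/
  | loop (a : ℕ) (P : Prog)

/-- The uniform distribution on `{0, …, N - 1}` (and `0` if `N = 0`). -/
def uniformBelow : ℕ → PMF ℕ
  | 0 => PMF.pure 0
  | N + 1 => (PMF.uniformOfFintype (Fin (N + 1))).map Fin.val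

/-- A communication partner: a randomized machine with states in `σ` which maps its current state
and an incoming message to a reply and a new state. -/
abbrev Peer (σ : Type) := σ → ℕ → PMF (ℕ × σ)

/-- The partner of a program that does not communicate. -/
def noPeer : Peer Unit := fun _ _ => PMF.pure (0, ())

/-- A configuration: registers, state of the communication partner, remaining budget. -/
structure Conf (σ : Type) where
  store : Store
  peer : σ
  fuel : ℕ

/-- Pay `k`; the value `none` means that the budget is exhausted. -/
def Conf.pay {σ : Type} (k : ℕ) (c : Conf σ) : Option (Conf σ) :=
  if k ≤ c.fuel then some { c with fuel := c.fuel - k } else none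

/-- Pay `k` plus the length of `v`, and write `v` into register `d`. -/
def Conf.write {σ : Type} (k d v : ℕ) (c : Conf σ) : Option (Conf σ) :=
  Conf.pay (k + v.size) { c with store := Function.update c.store d v }

/-- Continue with `f` unless the budget is exhausted. -/
def andThen {σ : Type} (μ : PMF (Option (Conf σ))) (f : Conf σ → PMF (Option (Conf σ))) :
    PMF (Option (Conf σ)) :=
  μ.bind fun o => o.elim (PMF.pure none) f

/-- At most `k` tests of the loop condition. -/
def loopEval {σ : Type} (a : ℕ) (body : Conf σ → PMF (Option (Conf σ))) :
    ℕ → Conf σ → PMF (Option (Conf σ))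
  | 0, _ => PMF.pure none
  | k + 1, c => andThen (PMF.pure (c.pay 1)) fun c' =>
      if c'.store a = 0 then PMF.pure (some c') else andThen (body c') (loopEval a body k)

/-- Run a program until it halts (`some` final configuration) or its budget is exhausted (`none`).
In a loop every test costs `1`, so that `c.fuel + 1` tests exhaust every budget. -/
def Prog.eval {σ : Type} (O : Peer σ) : Prog → Conf σ → PMF (Option (Conf σ))
  | .skip, c => PMF.pure (c.pay 1)
  | .const d v, c => PMF.pure (c.write 1 d v)
  | .arith op d a b, c =>
      PMF.pure (c.write (1 + (c.store a).size + (c.store b).size) d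
        (op.apply (c.store a) (c.store b)))
  | .powMod d a b m, c =>
      PMF.pure (c.write (1 + (c.store a).size + (c.store b).size + (c.store m).size) d
        (powModVal (c.store a) (c.store b) (c.store m)))
  | .rand d a, c =>
      (uniformBelow (c.store a)).map fun v => c.write (1 + (c.store a).size) d v
  | .call d a, c =>
      (O c.peer (c.store a)).map fun out =>
        Conf.write (1 + (c.store a).size) d out.1 { c with peer := out.2 }
  | .seq P Q, c => andThen (P.eval O c) (Q.eval O)
  | .cond a P Q, c => andThen (PMF.pure (c.pay 1)) fun c' =>
      if c'.store a = 0 then Q.eval O c' else P.eval O c'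
  | .loop a P, c => loopEval a (P.eval O) (c.fuel + 1) c

/-- From registers `st` and partner state `s`, every run of `P` halts with cost at most `T`. -/
def Prog.HaltsWithin {σ : Type} (P : Prog) (O : Peer σ) (st : Store) (s : σ) (T : ℕ) : Prop :=
  none ∉ (P.eval O ⟨st, s, T⟩).support

open Classical in
/-- The joint distribution of the final registers and the final partner state. It does not depend
on the budget as long as this suffices for all runs; programs without a sufficient budget are
never used (they get a dummy value). -/
def Prog.result {σ : Type} (P : Prog) (O : Peer σ) (st : Store) (s : σ) : PMF (Store × σ) :=
  if h : ∃ T, P.HaltsWithin O st s T then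
    (P.eval O ⟨st, s, h.choose⟩).map fun o => o.elim (st, s) fun c => (c.store, c.peer)
  else PMF.pure (st, s)

/-- Probabilistic polynomial time: on input `κ` (the security parameter, counted in unary) and
`xs` every run halts within a cost polynomial in `κ`, the number of inputs in `xs`, and the
maximal length `L` of an entry of `xs` or of a reply that is received. Here `I` is a set of states
that the partner never leaves. -/
def Prog.PolyTime (P : Prog) : Prop :=
  ∃ T : Polynomial ℕ, ∀ (κ L : ℕ) (xs : List ℕ) (σ : Type) (O : Peer σ) (s : σ) (I : σ → Prop),
    (∀ x ∈ xs, x < 2 ^ L) → I s →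
    (∀ t m, I t → ∀ out ∈ (O t m).support, out.1 < 2 ^ L ∧ I out.2) →
    P.HaltsWithin O (Store.ofList (κ :: xs)) s (T.eval (κ + xs.length + L))

/-! ### Computational indistinguishability -/

/-- A negligible function of the security parameter. -/
def Negligible (f : ℕ → ℝ) : Prop :=
  SuperpolynomialDecay atTop (fun κ : ℕ => (κ : ℝ)) f

/-- What a distinguisher is confronted with: a random input, and a partner to talk to. -/
structure Experiment where
  State : Type
  peer : Peer State
  init : State
  input : PMF (List ℕ)

/-- The probability that the distinguisher `P` ends with output `1` in register `0`. -/
def Experiment.prob (E : Experiment) (P : Prog) : ℝ :=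
  ((E.input.bind fun l => (P.result E.peer (Store.ofList l) E.init).map fun out => out.1 0)
    1).toReal

/-- No probabilistic polynomial-time distinguisher has a non-negligible advantage. -/
def Indistinguishable (E₀ E₁ : ℕ → Experiment) : Prop :=
  ∀ P : Prog, P.PolyTime → Negligible fun κ => |(E₀ κ).prob P - (E₁ κ).prob P|

/-! ### The group and the Diffie–Hellman assumption -/

/-- For every security parameter `κ` a prime `q` of polynomial length and an element `g` of the
group of units modulo `q`. The cryptographic group is the subgroup generated by `g`; it is the
full group of units if `g` is a primitive root. -/
structure GroupFamily where
  q : ℕ → ℕ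
  prime : ∀ κ, (q κ).Prime
  g : ∀ κ, (ZMod (q κ))ˣ
  length : ∃ ℓ : Polynomial ℕ, ∀ κ, q κ < 2 ^ ℓ.eval κ

namespace GroupFamily

variable (F : GroupFamily) (κ : ℕ)

/-- The group `G`. -/
abbrev G : Subgroup (ZMod (F.q κ))ˣ := Subgroup.zpowers (F.g κ)

instance : NeZero (F.q κ) := ⟨(F.prime κ).ne_zero⟩

instance : NeZero (orderOf (F.g κ)) := ⟨(orderOf_pos (F.g κ)).ne'⟩

/-- Exponents of `g`, as residues modulo the order of `G`. -/
abbrev Exponent : Type := Fin (orderOf (F.g κ))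

/-- The public parameters: `κ`, `q`, `g` and the order of `G`. -/
def params : List ℕ := [κ, F.q κ, (F.g κ : ZMod (F.q κ)).val, orderOf (F.g κ)]

/-- The residue that represents `g ^ a`. -/
def power (a : ℕ) : ℕ := ((F.g κ ^ a : (ZMod (F.q κ))ˣ) : ZMod (F.q κ)).val

/-- The public parameters together with `g ^ a`, `g ^ b`, `g ^ (a * b)`. -/
def ddhReal : Experiment where
  State := Unit
  peer := noPeer
  init := ()
  input := do
    let a ← PMF.uniformOfFintype (F.Exponent κ)
    let b ← PMF.uniformOfFintype (F.Exponent κ)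
    return F.params κ ++ [F.power κ a, F.power κ b, F.power κ (a * b : ℕ)]

/-- The public parameters together with `g ^ a`, `g ^ b`, `g ^ c`. -/
def ddhRandom : Experiment where
  State := Unit
  peer := noPeer
  init := ()
  input := do
    let a ← PMF.uniformOfFintype (F.Exponent κ)
    let b ← PMF.uniformOfFintype (F.Exponent κ)
    let c ← PMF.uniformOfFintype (F.Exponent κ)
    return F.params κ ++ [F.power κ a, F.power κ b, F.power κ c]

/-- The (decisional) Diffie–Hellman assumption. -/
def DiffieHellman : Prop := Indistinguishable F.ddhReal F.ddhRandom

end GroupFamily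

/-! ### Oblivious transfer -/

/-- The programs of a two-party protocol. The sender sends messages with `call`. The receiver is
run once for each incoming message, keeping its registers in between: it finds the message in
register `0` and leaves its reply there. Register `1` holds the receiver's choice at the start and
the string it has received at the end. -/
structure OTProtocol where
  sender : Prog
  receiver : Prog

namespace OTProtocol

variable (ot : OTProtocol)

/-- The registers of the receiver at the start, for a common input and a choice `r`. -/
def receiverInit (common : List ℕ) (r : ℕ) : Store := Store.ofList (0 :: r :: common)

/-- The honest receiver as a communication partner. -/
def receiverPeer : Peer Store := fun st m =>
  (ot.receiver.result noPeer (Function.update st 0 m) ()).map fun out => (out.1 0, out.1)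

/-- The states which the receiver can reach from `st₀` through messages of at most `L` bits. -/
inductive Reachable (L : ℕ) (st₀ : Store) : Store → Prop
  | init : Reachable L st₀ st₀
  | step (st : Store) (m : ℕ) (out : ℕ × Store) (h : Reachable L st₀ st) (hm : m < 2 ^ L)
      (hout : out ∈ (ot.receiverPeer st m).support) : Reachable L st₀ out.2

/-- The honest receiver of a 1-out-of-`N` transfer is efficient: a reply costs at most a polynomial
in the security parameter, the length of the common input, and the length of the messages so far;
the length of a reply is polynomial in the security parameter and the length of the common
input. -/
def EfficientReceiver (N : ℕ) : Prop :=
  ∃ T M : Polynomial ℕ, ∀ (κ L K : ℕ) (xs : List ℕ) (r : Fin N), (∀ x ∈ xs, x < 2 ^ L) →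
    ∀ st, ot.Reachable K (receiverInit (κ :: xs) r) st → ∀ m < 2 ^ K,
      ot.receiver.HaltsWithin noPeer (Function.update st 0 m) ()
        (T.eval (κ + xs.length + L + K)) ∧
      ∀ out ∈ (ot.receiverPeer st m).support, out.1 < 2 ^ M.eval (κ + xs.length + L)

/-- With honest parties the receiver obtains the chosen string, up to a negligible error. The
strings are numbers below `q`. -/
def Correct (F : GroupFamily) (N : ℕ) : Prop :=
  ∃ ε : ℕ → ℝ, Negligible ε ∧ ∀ (κ : ℕ) (s : Fin N → ℕ) (r : Fin N), (∀ j, s j < F.q κ) →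
    1 - ε κ ≤ (((ot.sender.result ot.receiverPeer (Store.ofList (F.params κ ++ List.ofFn s))
      (receiverInit (F.params κ) r)).map fun out => out.2 1) (s r)).toReal

/-- `ot` is a 1-out-of-`N` oblivious transfer protocol for strings below `q`. -/
structure IsOT (F : GroupFamily) (N : ℕ) : Prop where
  sender : ot.sender.PolyTime
  receiver : ot.EfficientReceiver N
  correct : ot.Correct F N

/-- A possibly malicious sender talks to the honest receiver whose choice is `r`. -/
def session (F : GroupFamily) {N : ℕ} (r : Fin N) (κ : ℕ) : Experiment where
  State := Store
  peer := ot.receiverPeer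
  init := receiverInit (F.params κ) r
  input := PMF.pure (F.params κ)

/-- Receiver security: no probabilistic polynomial-time sender can tell two choices apart. -/
def ReceiverSecure (F : GroupFamily) (N : ℕ) : Prop :=
  ∀ r r' : Fin N, r < r' → Indistinguishable (ot.session F r) (ot.session F r')

end OTProtocol

/-! ### The election -/

/-- Admissible primes for `n` voters: distinct primes in `G` whose `n`-th powers are below `q`. -/
structure AdmissiblePrimes (F : GroupFamily) (κ n : ℕ) {N : ℕ} (p : Fin N → ℕ) : Prop where
  injective : Function.Injective p
  prime : ∀ j, (p j).Prime
  pow_lt : ∀ j, p j ^ n < F.q κ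
  mem : ∀ j, ∃ u ∈ F.G κ, (u : ZMod (F.q κ)) = p j

/-- The final registers of the distributor's program for the election setup: the registers
`0, …, N - 1` hold the primes, and register `N` any further information the distributor keeps. -/
def setupResult (F : GroupFamily) (setup : Prog) (κ : ℕ) : PMF Store :=
  (setup.result noPeer (Store.ofList (F.params κ)) ()).map Prod.fst

/-- The distributor's program runs in polynomial time and always chooses admissible primes. -/
def AdmissibleSetup (F : GroupFamily) (n N : ℕ) (setup : Prog) : Prop :=
  setup.PolyTime ∧ ∀ κ, ∀ st ∈ (setupResult F setup κ).support,
    AdmissiblePrimes F κ n (fun j : Fin N => st j)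

namespace Election

variable (F : GroupFamily) (ot : OTProtocol) (setup : Prog) {n N : ℕ} (i : Fin n)

/-- The public key of the set of voters with private keys `d`. -/
def publicKey (κ : ℕ) (d : Fin n → F.Exponent κ) : (ZMod (F.q κ))ˣ := ∏ j, F.g κ ^ (d j : ℕ)

/-- The ballot `p * g ^ s * e ^ x`. -/
def ballot (κ p s x : ℕ) (e : (ZMod (F.q κ))ˣ) : ZMod (F.q κ) :=
  p * (F.g κ : ZMod (F.q κ)) ^ s * (e : ZMod (F.q κ)) ^ x

/-- All that the other voters, including the distributor, jointly know when voter `i` has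
published the ciphertext `(g ^ x, b)`: the public parameters, all public keys, all private keys
but that of voter `i`, the primes and the distributor's further information, and the mask. -/
def view (κ : ℕ) (d : Fin n → F.Exponent κ) (st : Store) (s x : F.Exponent κ)
    (b : ZMod (F.q κ)) (N : ℕ) : List ℕ :=
  F.params κ ++ List.ofFn (fun j => F.power κ (d j))
    ++ List.ofFn (fun j => if j = i then 0 else (d j : ℕ))
    ++ List.ofFn (fun j : Fin (N + 1) => st j) ++ [(s : ℕ), F.power κ x, b.val]

/-- The adversary sees the true ballot of voter `i`, who votes with the prime of index `r`, and
acts as the sender in the oblivious transfer with this voter. -/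
def real (r : Fin N) (κ : ℕ) : Experiment where
  State := Store
  peer := ot.receiverPeer
  init := OTProtocol.receiverInit (F.params κ) r
  input := do
    let d ← PMF.uniformOfFintype (Fin n → F.Exponent κ)
    let st ← setupResult F setup κ
    let s ← PMF.uniformOfFintype (F.Exponent κ)
    let x ← PMF.uniformOfFintype (F.Exponent κ)
    return view F i κ d st s x (ballot F κ (st r) s x (publicKey F κ d)) N

/-- The same with a uniformly random element `g ^ u` of `G` instead of the ballot; in the oblivious
transfer the voter asks for the index `r`. -/
def random (r : Fin N) (κ : ℕ) : Experiment where
  State := Store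
  peer := ot.receiverPeer
  init := OTProtocol.receiverInit (F.params κ) r
  input := do
    let d ← PMF.uniformOfFintype (Fin n → F.Exponent κ)
    let st ← setupResult F setup κ
    let s ← PMF.uniformOfFintype (F.Exponent κ)
    let x ← PMF.uniformOfFintype (F.Exponent κ)
    let u ← PMF.uniformOfFintype (F.Exponent κ)
    return view F i κ d st s x ((F.g κ ^ (u : ℕ) : (ZMod (F.q κ))ˣ) : ZMod (F.q κ)) N

end Election

end

/-! ### Couplings -/

/-! The proof is a hybrid argument with one intermediate experiment: the ballot is already uniform,
while the receiver still uses the choice `r`.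

The first step uses the Diffie–Hellman assumption. Put a = d_i and b = x_i. The ballot p g^s e^x
equals g^(ab) · p · g^s · ∏_{j≠i} (g^b)^(d_j), so whoever is given (g^a, g^b, z) can sample all the
other data and form the view with z in place of g^(ab). For z = g^(ab) this is the real view
(`ballotValue_eq_ballot`). For z = g^c the remaining factor lies in G, because the primes do, and
translation by it preserves the uniform distribution on G (`bind_ballotValue`). The adversary also
expects a partner in the oblivious transfer, and a distinguisher of triples has none; it therefore
runs the honest receiver with choice `r` itself (`inlineRun`). The result is
`indistinguishable_real_random`.

The second step uses receiver security. Once the ballot is uniform, the view does not depend on the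
choice in the transfer. A malicious sender draws a, b, c itself, builds the view in the same way,
and forwards the adversary's messages to the real receiver (`attack`). Its success probability
against choice r' is exactly that of the adversary in the random experiment for r'
(`prob_session_attack`). The triangle inequality joins the two steps.

Most of the work is to show that these reductions are programs of polynomial cost with the claimed
output distributions. Runs are compared by couplings. `Prog.coupled_embed` transports a run through
a renaming of registers and a replacement of the communication, at the price of a constant factor in
the budget. Cost is handled separately by `Prog.Efficient`, a form of polynomial time that is stable
under composition. Once halting is known, `Halts.coupled_seq` follows the distributions without any
accounting of cost. -/

theorem PMF.bind_congr_support {α β : Type} {μ : PMF α} {f g : α → PMF β}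
    (h : ∀ a ∈ μ.support, f a = g a) : μ.bind f = μ.bind g := by
  ext x
  simp only [PMF.bind_apply]
  refine tsum_congr fun a => ?_
  by_cases ha : a ∈ μ.support
  · rw [h a ha]
  · rw [(PMF.apply_eq_zero_iff μ a).2 ha, zero_mul, zero_mul]

/-- There is a coupling of `μ` and `ν` that is supported on the relation `R`. -/
def PMF.Coupled {α β : Type} (R : α → β → Prop) (μ : PMF α) (ν : PMF β) : Prop :=
  ∃ γ : PMF (α × β), γ.map Prod.fst = μ ∧ γ.map Prod.snd = ν ∧ ∀ p ∈ γ.support, R p.1 p.2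

namespace PMF.Coupled

variable {α β α' β' : Type} {R : α → β → Prop} {S : α' → β' → Prop} {μ : PMF α} {ν : PMF β}

theorem pure {a : α} {b : β} (h : R a b) : Coupled R (PMF.pure a) (PMF.pure b) :=
  ⟨PMF.pure (a, b), PMF.pure_map _ _, PMF.pure_map _ _, by simpa using h⟩

theorem refl {R : α → α → Prop} (h : ∀ a ∈ μ.support, R a a) : Coupled R μ μ := by
  refine ⟨μ.map fun a => (a, a), ?_, ?_, ?_⟩
  · rw [PMF.map_comp]; exact PMF.map_id μ
  · rw [PMF.map_comp]; exact PMF.map_id μ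
  · intro p hp
    obtain ⟨a, ha, rfl⟩ := (PMF.mem_support_map_iff _ _ _).1 hp
    exact h a ha

theorem mono_support {R' : α → β → Prop} (h : Coupled R μ ν)
    (hR : ∀ a ∈ μ.support, ∀ b ∈ ν.support, R a b → R' a b) : Coupled R' μ ν := by
  obtain ⟨γ, rfl, rfl, hγ⟩ := h
  refine ⟨γ, rfl, rfl, fun p hp => hR _ ?_ _ ?_ (hγ p hp)⟩
  · exact (PMF.mem_support_map_iff _ _ _).2 ⟨p, hp, rfl⟩
  · exact (PMF.mem_support_map_iff _ _ _).2 ⟨p, hp, rfl⟩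

theorem mono {R' : α → β → Prop} (h : Coupled R μ ν) (hR : ∀ a b, R a b → R' a b) :
    Coupled R' μ ν :=
  h.mono_support fun a _ b _ => hR a b

theorem bind {f : α → PMF α'} {g : β → PMF β'} (h : Coupled R μ ν)
    (hfg : ∀ a b, R a b → Coupled S (f a) (g b)) : Coupled S (μ.bind f) (ν.bind g) := by
  classical
  obtain ⟨γ, rfl, rfl, hγ⟩ := h
  -- The couplings are chosen for all pairs at once. Off `R` any distribution serves, since `γ`
  -- gives such pairs no mass; the product is taken.
  have key : ∀ p : α × β, ∃ δ : PMF (α' × β'), R p.1 p.2 →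
      δ.map Prod.fst = f p.1 ∧ δ.map Prod.snd = g p.2 ∧ ∀ p ∈ δ.support, S p.1 p.2 := by
    intro p
    by_cases hp : R p.1 p.2
    · obtain ⟨δ, hδ⟩ := hfg _ _ hp
      exact ⟨δ, fun _ => hδ⟩
    · exact ⟨(f p.1).bind fun x => (g p.2).map fun y => (x, y), fun h => absurd h hp⟩
  choose δ hδ using key
  refine ⟨γ.bind δ, ?_, ?_, ?_⟩
  · rw [PMF.map_bind, PMF.bind_map]
    exact PMF.bind_congr_support fun p hp => (hδ p (hγ p hp)).1
  · rw [PMF.map_bind, PMF.bind_map]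
    exact PMF.bind_congr_support fun p hp => (hδ p (hγ p hp)).2.1
  · intro x hx
    obtain ⟨p, hp, hx⟩ := (PMF.mem_support_bind_iff _ _ _).1 hx
    exact (hδ p (hγ p hp)).2.2 x hx

theorem map {f : α → α'} {g : β → β'} (h : Coupled R μ ν)
    (hfg : ∀ a b, R a b → S (f a) (g b)) : Coupled S (μ.map f) (ν.map g) :=
  h.bind fun a b hab => .pure (hfg a b hab)

/-- The product coupling works. It settles the cases in which the left run is out of budget, where
`OptRel` demands nothing. -/
theorem of_left (h : ∀ a ∈ μ.support, ∀ b, R a b) : Coupled R μ ν := by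
  refine ⟨μ.bind fun a => ν.map fun b => (a, b), ?_, ?_, ?_⟩
  · simp only [PMF.map_bind, PMF.map_comp]
    conv_rhs => rw [← PMF.bind_pure μ]
    refine congrArg _ (funext fun a => ?_)
    exact PMF.map_const ν a
  · simp only [PMF.map_bind, PMF.map_comp]
    refine (congrArg _ (funext fun a => ?_)).trans (PMF.bind_const μ ν)
    exact PMF.map_id ν
  · intro p hp
    obtain ⟨a, ha, hp⟩ := (PMF.mem_support_bind_iff _ _ _).1 hp
    obtain ⟨b, -, rfl⟩ := (PMF.mem_support_map_iff _ _ _).1 hp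
    exact h a ha b

theorem exists_left (h : Coupled R μ ν) {b : β} (hb : b ∈ ν.support) :
    ∃ a ∈ μ.support, R a b := by
  obtain ⟨γ, rfl, rfl, hγ⟩ := h
  obtain ⟨p, hp, rfl⟩ := (PMF.mem_support_map_iff _ _ _).1 hb
  exact ⟨p.1, (PMF.mem_support_map_iff _ _ _).2 ⟨p, hp, rfl⟩, hγ p hp⟩

/-- The way back from couplings to equality of distributions. -/
theorem map_eq {γ : Type} {f : α → γ} {g : β → γ} (h : Coupled R μ ν)
    (hfg : ∀ a b, R a b → f a = g b) : μ.map f = ν.map g := by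
  obtain ⟨γ, rfl, rfl, hγ⟩ := h
  rw [PMF.map_comp, PMF.map_comp]
  refine PMF.bind_congr_support fun p hp => ?_
  simp only [Function.comp_apply, hfg _ _ (hγ p hp)]

theorem map_left (f : α → α') (μ : PMF α) : Coupled (fun y x => f x = y) (μ.map f) μ := by
  conv => arg 3; rw [← PMF.map_id μ]
  exact Coupled.map (R := (· = ·)) (.refl fun _ _ => rfl) (by rintro a _ rfl; rfl)

end PMF.Coupled

/-! ### Simulation of programs -/

/-- Rename the registers of a program by `ρ` and replace its communication by the programs `f`. -/
def Prog.embed (ρ : ℕ → ℕ) (f : ℕ → ℕ → Prog) : Prog → Prog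
  | .skip => .skip
  | .const d v => .const (ρ d) v
  | .arith op d a b => .arith op (ρ d) (ρ a) (ρ b)
  | .powMod d a b c => .powMod (ρ d) (ρ a) (ρ b) (ρ c)
  | .rand d a => .rand (ρ d) (ρ a)
  | .call d a => f d a
  | .seq P Q => .seq (P.embed ρ f) (Q.embed ρ f)
  | .cond a P Q => .cond (ρ a) (P.embed ρ f) (Q.embed ρ f)
  | .loop a P => .loop (ρ a) (P.embed ρ f)

/-- `R` holds for the contents of the two options, unless the first one is empty. -/
def OptRel {α β : Type} (R : α → β → Prop) (o : Option α) (o' : Option β) : Prop :=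
  ∀ x, o = some x → ∃ y, o' = some y ∧ R x y

/-- The states are related by `R`, and the second budget is at least `C` times the first one,
which is at most `K`, with `e` to spare. -/
def Conf.Rel {σ τ : Type} (C e K : ℕ) (R : Store → σ → Store → τ → Prop) (c : Conf σ)
    (c' : Conf τ) : Prop :=
  R c.store c.peer c'.store c'.peer ∧ c.fuel ≤ K ∧ C * c.fuel + e ≤ c'.fuel

section Simulation

variable {σ τ : Type} {C e K : ℕ} {R : Store → σ → Store → τ → Prop}

/-- A payment `k` on the left releases `C * k` on the right, so the reserve `e` is untouched. -/
theorem OptRel.pay {k k' : ℕ} {c : Conf σ} {c' : Conf τ} (h : c.Rel C e K R c')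
    (hk : k' ≤ C * k) : OptRel (Conf.Rel C e K R) (c.pay k) (c'.pay k') := by
  intro x hx
  obtain ⟨h1, h2, h3⟩ := h
  unfold Conf.pay at hx ⊢
  split_ifs at hx with hle
  have hmul : C * c.fuel = C * (c.fuel - k) + C * k := by
    rw [← Nat.mul_add, Nat.sub_add_cancel hle]
  cases hx
  rw [if_pos (by omega)]
  refine ⟨_, rfl, h1, ?_, ?_⟩
  · simp only; omega
  · simp only; omega

theorem OptRel.write {k k' d d' v : ℕ} {c : Conf σ} {c' : Conf τ} (h : c.Rel C e K R c')
    (hR : R (Function.update c.store d v) c.peer (Function.update c'.store d' v) c'.peer)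
    (hk : k' + v.size ≤ C * (k + v.size)) :
    OptRel (Conf.Rel C e K R) (c.write k d v) (c'.write k' d' v) :=
  OptRel.pay (c := { c with store := Function.update c.store d v })
    (c' := { c' with store := Function.update c'.store d' v }) ⟨hR, h.2⟩ hk

theorem PMF.Coupled.andThen {R : Conf σ → Conf τ → Prop}
    {S : Conf σ → Conf τ → Prop} {μ : PMF (Option (Conf σ))} {ν : PMF (Option (Conf τ))}
    {f : Conf σ → PMF (Option (Conf σ))} {g : Conf τ → PMF (Option (Conf τ))}
    (h : PMF.Coupled (OptRel R) μ ν)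
    (hfg : ∀ c c', R c c' → PMF.Coupled (OptRel S) (f c) (g c')) :
    PMF.Coupled (OptRel S) (_root_.andThen μ f) (_root_.andThen ν g) := by
  refine h.bind fun o o' ho => ?_
  cases o with
  | none =>
    refine .of_left fun a ha b x hx => ?_
    have : a = none := by simpa using ha
    simp [this] at hx
  | some c =>
    obtain ⟨c', rfl, hc⟩ := ho c rfl
    exact hfg c c' hc

theorem PMF.Coupled.loopEval {a a' : ℕ} {body : Conf σ → PMF (Option (Conf σ))}
    {body' : Conf τ → PMF (Option (Conf τ))} (hC : 1 ≤ C)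
    (ha : ∀ c c', Conf.Rel C e K R c c' → c'.store a' = c.store a)
    (hbody : ∀ c c', Conf.Rel C e K R c c' →
      PMF.Coupled (OptRel (Conf.Rel C e K R)) (body c) (body' c')) :
    ∀ k k' : ℕ, k ≤ k' → ∀ c c', Conf.Rel C e K R c c' →
      PMF.Coupled (OptRel (Conf.Rel C e K R)) (_root_.loopEval a body k c)
        (_root_.loopEval a' body' k' c') := by
  intro k
  induction k with
  | zero =>
    intro k' _ c c' _
    refine .of_left fun a ha b x hx => ?_
    have : a = none := by simpa [_root_.loopEval] using ha
    simp [this] at hx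
  | succ k ih =>
    intro k' hk c c' hc
    obtain ⟨k', rfl⟩ : ∃ j, k' = j + 1 := ⟨k' - 1, by omega⟩
    refine .andThen (.pure (OptRel.pay hc (by omega))) fun c₁ c₁' h₁ => ?_
    rw [ha _ _ h₁]
    split_ifs
    · refine .pure fun x hx => ?_
      cases hx
      exact ⟨_, rfl, h₁⟩
    · exact .andThen (hbody _ _ h₁) (ih k' (by omega))

/-- Every instruction other than `call` is copied with renamed registers at the same cost, so `1 ≤
C` pays for it. Each application only has to justify its treatment of communication. A loop on the
right has at least as many tests available, because its budget is larger. -/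
theorem Prog.coupled_embed {O : Peer σ} {O' : Peer τ} {ρ : ℕ → ℕ} {f : ℕ → ℕ → Prog} (hC : 1 ≤ C)
    (hread : ∀ st s S s', R st s S s' → ∀ a, S (ρ a) = st a)
    (hwrite : ∀ st s S s', R st s S s' → ∀ d v,
      R (Function.update st d v) s (Function.update S (ρ d) v) s')
    (hcall : ∀ d a c c', Conf.Rel C e K R c c' → PMF.Coupled (OptRel (Conf.Rel C e K R))
      ((Prog.call d a).eval O c) ((f d a).eval O' c')) (P : Prog) :
    ∀ c c', Conf.Rel C e K R c c' → PMF.Coupled (OptRel (Conf.Rel C e K R))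
      (P.eval O c) ((P.embed ρ f).eval O' c') := by
  have hmul : ∀ k, k ≤ C * k := fun k => Nat.le_mul_of_pos_left k hC
  induction P with
  | skip => exact fun c c' h => .pure (OptRel.pay h (by omega))
  | const d v => exact fun c c' h => .pure (OptRel.write h (hwrite _ _ _ _ h.1 d v) (hmul _))
  | arith op d a b =>
    intro c c' h
    simp only [embed, eval, hread _ _ _ _ h.1]
    exact .pure (OptRel.write h (hwrite _ _ _ _ h.1 _ _) (hmul _))
  | powMod d a b m =>
    intro c c' h
    simp only [embed, eval, hread _ _ _ _ h.1]
    exact .pure (OptRel.write h (hwrite _ _ _ _ h.1 _ _) (hmul _))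
  | rand d a =>
    intro c c' h
    simp only [embed, eval, hread _ _ _ _ h.1]
    refine PMF.Coupled.map (R := (· = ·)) (.refl fun _ _ => rfl) ?_
    rintro v _ rfl
    exact OptRel.write h (hwrite _ _ _ _ h.1 _ _) (hmul _)
  | call d a => exact hcall d a
  | seq P Q ihP ihQ => exact fun c c' h => .andThen (ihP c c' h) ihQ
  | cond a P Q ihP ihQ =>
    intro c c' h
    refine .andThen (.pure (OptRel.pay h (by omega))) fun c₁ c₁' h₁ => ?_
    rw [hread _ _ _ _ h₁.1]
    split_ifs
    · exact ihQ _ _ h₁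
    · exact ihP _ _ h₁
  | loop a P ih =>
    intro c c' h
    have := hmul c.fuel
    exact .loopEval hC (fun c c' h => hread _ _ _ _ h.1 a) ih _ _ (by have := h.2.2; omega) c c' h

end Simulation

/-! ### Halting programs and their results -/

namespace Prog

variable {σ τ : Type} {O : Peer σ} {O' : Peer τ} {P Q : Prog} {st : Store} {s : σ} {T T' : ℕ}

theorem embed_id (P : Prog) : P.embed id Prog.call = P := by
  induction P with
  | seq P Q ihP ihQ => simp only [embed, ihP, ihQ]
  | cond a P Q ihP ihQ => simp only [embed, ihP, ihQ, id]
  | loop a P ih => simp only [embed, ih, id]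
  | _ => rfl

/-- The identity embedding with `C = 1`: additional budget changes nothing in the runs that halt,
and it is left over at the end. -/
theorem coupled_eval_fuel (O : Peer σ) (P : Prog) (st : Store) (s : σ) (T e : ℕ) :
    PMF.Coupled (OptRel fun c c' : Conf σ =>
        c'.store = c.store ∧ c'.peer = c.peer ∧ c.fuel + e ≤ c'.fuel)
      (P.eval O ⟨st, s, T⟩) (P.eval O ⟨st, s, T + e⟩) := by
  have key := coupled_embed (C := 1) (e := e) (K := T) (O := O) (O' := O) (ρ := id)
    (f := Prog.call) (R := fun st s S s' => S = st ∧ s' = s) le_rfl (by simp) (by simp)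
    (by
      intro d a c c' h
      obtain ⟨⟨h1, h2⟩, h3⟩ := id h
      simp only [eval, h1, h2]
      refine PMF.Coupled.map (R := (· = ·)) (.refl fun _ _ => rfl) ?_
      rintro v _ rfl
      have h' : Conf.Rel 1 e T (fun st s S s' => S = st ∧ s' = s) { c with peer := v.2 }
        { c' with store := c.store, peer := v.2 } := ⟨⟨rfl, rfl⟩, h3⟩
      exact OptRel.write h' ⟨by simp, rfl⟩ (by simp)) P ⟨st, s, T⟩ ⟨st, s, T + e⟩
    ⟨⟨rfl, rfl⟩, le_rfl, by simp⟩
  rw [embed_id] at key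
  refine key.mono fun o o' h x hx => ?_
  obtain ⟨y, hy, h1, -, h2⟩ := h x hx
  exact ⟨y, hy, h1.1, h1.2, by simpa using h2⟩

/-- The outcome of a halting evaluation. -/
def Final {σ : Type} (e : ℕ) (out : Store × σ) (o : Option (Conf σ)) : Prop :=
  ∃ c, o = some c ∧ (c.store, c.peer) = out ∧ e ≤ c.fuel

theorem HaltsWithin.mono (h : P.HaltsWithin O st s T) (hT : T ≤ T') :
    P.HaltsWithin O st s T' := by
  obtain ⟨e, rfl⟩ := Nat.exists_eq_add_of_le hT
  intro hn
  obtain ⟨o, ho, hR⟩ := (coupled_eval_fuel O P st s T e).exists_left hn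
  cases o with
  | none => exact h ho
  | some c => obtain ⟨y, hy, -⟩ := hR c rfl; cases hy

/-- Two sufficient budgets are comparable, and the larger one yields the same outcome; hence the
budget chosen inside `result` is immaterial. -/
theorem HaltsWithin.result_eq (h : P.HaltsWithin O st s T) :
    P.result O st s =
      (P.eval O ⟨st, s, T⟩).map fun o => o.elim (st, s) fun c => (c.store, c.peer) := by
  have key : ∀ {T T' : ℕ}, P.HaltsWithin O st s T → T ≤ T' →
      ((P.eval O ⟨st, s, T⟩).map fun o => o.elim (st, s) fun c => (c.store, c.peer)) =
      (P.eval O ⟨st, s, T'⟩).map fun o => o.elim (st, s) fun c => (c.store, c.peer) := by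
    intro T T' h hT
    obtain ⟨e, rfl⟩ := Nat.exists_eq_add_of_le hT
    refine PMF.Coupled.map_eq
      (R := fun o o' => ∃ c c', o = some c ∧ o' = some c' ∧ c'.store = c.store ∧ c'.peer = c.peer)
      ((coupled_eval_fuel O P st s T e).mono_support fun o ho o' _ hR => ?_) ?_
    · cases o with
      | none => exact absurd ho h
      | some c => obtain ⟨y, hy, h1, h2, -⟩ := hR c rfl; exact ⟨c, y, rfl, hy, h1, h2⟩
    · rintro _ _ ⟨c, c', rfl, rfl, h1, h2⟩
      simp [h1, h2]
  have hex : ∃ T, P.HaltsWithin O st s T := ⟨T, h⟩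
  rw [result, dif_pos hex]
  rcases le_total hex.choose T with hle | hle
  · exact key hex.choose_spec hle
  · exact (key h hle).symm

theorem HaltsWithin.coupled_result (h : P.HaltsWithin O st s T) (e : ℕ) :
    PMF.Coupled (Final e) (P.result O st s) (P.eval O ⟨st, s, T + e⟩) := by
  rw [h.result_eq]
  have := (coupled_eval_fuel O P st s T e).mono_support (R' := fun o o' => ∃ c c', o = some c ∧
    o' = some c' ∧ c'.store = c.store ∧ c'.peer = c.peer ∧ c.fuel + e ≤ c'.fuel) fun o ho o' _ hR => by
      cases o with
      | none => exact absurd ho h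
      | some c => obtain ⟨y, hy, h1⟩ := hR c rfl; exact ⟨c, y, rfl, hy, h1⟩
  have := this.map (S := Final e) (f := fun o => o.elim (st, s) fun c => (c.store, c.peer))
    (g := id) (by
      rintro _ _ ⟨c, c', rfl, rfl, h1, h2, h3⟩
      exact ⟨c', rfl, by simp [h1, h2], by omega⟩)
  rwa [PMF.map_id] at this

/-- A coupling along `Final` excludes the outcome `none`, so it proves halting and determines the
result at the same time. -/
theorem runs_of_coupled {μ : PMF (Store × σ)}
    (h : PMF.Coupled (Final 0) μ (P.eval O ⟨st, s, T⟩)) :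
    P.HaltsWithin O st s T ∧ P.result O st s = μ := by
  have hT : P.HaltsWithin O st s T := by
    intro hn
    obtain ⟨_, -, c, hc, -⟩ := h.exists_left hn
    cases hc
  refine ⟨hT, ?_⟩
  rw [hT.result_eq, ← h.map_eq (f := id), PMF.map_id]
  rintro _ _ ⟨c, rfl, rfl, -⟩
  rfl

theorem HaltsWithin.runs_seq {T₁ T₂ : ℕ} (hP : P.HaltsWithin O st s T₁)
    (hQ : ∀ out ∈ (P.result O st s).support, Q.HaltsWithin O out.1 out.2 T₂) :
    (P.seq Q).HaltsWithin O st s (T₁ + T₂) ∧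
      (P.seq Q).result O st s = (P.result O st s).bind fun out => Q.result O out.1 out.2 := by
  refine runs_of_coupled ?_
  have := (hP.coupled_result T₂).mono_support (R' := fun out o => Final T₂ out o ∧
    out ∈ (P.result O st s).support) fun a ha b _ h => ⟨h, ha⟩
  refine this.bind ?_
  rintro _ _ ⟨⟨c, rfl, rfl, h⟩, hc⟩
  obtain ⟨e, he⟩ := Nat.exists_eq_add_of_le h
  have := ((hQ _ hc).coupled_result e).mono (R' := Final 0) (by
    rintro a b ⟨c, h1, h2, -⟩
    exact ⟨c, h1, h2, Nat.zero_le _⟩)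
  rwa [← he] at this

/-- The program halts. -/
def Halts (P : Prog) (O : Peer σ) (st : Store) (s : σ) : Prop := ∃ T, P.HaltsWithin O st s T

theorem runs_pay (d v k : ℕ) (hT : k + v.size ≤ T) :
    PMF.Coupled (Final 0) (PMF.pure (Function.update st d v, s))
      (PMF.pure (Conf.write k d v ⟨st, s, T⟩)) := by
  refine .pure ?_
  rw [Conf.write, Conf.pay, if_pos hT]
  exact ⟨_, rfl, rfl, Nat.zero_le _⟩

theorem runs_skip (O : Peer σ) (st : Store) (s : σ) :
    Prog.skip.HaltsWithin O st s 1 ∧ Prog.skip.result O st s = PMF.pure (st, s) :=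
  runs_of_coupled (.pure ⟨⟨st, s, 0⟩, by simp [Conf.pay], rfl, le_rfl⟩)

theorem runs_const (O : Peer σ) (st : Store) (s : σ) (d v : ℕ) :
    (Prog.const d v).HaltsWithin O st s (1 + v.size) ∧
      (Prog.const d v).result O st s = PMF.pure (Function.update st d v, s) :=
  runs_of_coupled (runs_pay d v 1 le_rfl)

theorem runs_arith (O : Peer σ) (st : Store) (s : σ) (op : ArithOp) (d a b : ℕ) :
    (Prog.arith op d a b).HaltsWithin O st s
        (1 + (st a).size + (st b).size + (op.apply (st a) (st b)).size) ∧
      (Prog.arith op d a b).result O st s =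
        PMF.pure (Function.update st d (op.apply (st a) (st b)), s) :=
  runs_of_coupled (runs_pay _ _ _ le_rfl)

theorem runs_powMod (O : Peer σ) (st : Store) (s : σ) (d a b m : ℕ) :
    (Prog.powMod d a b m).HaltsWithin O st s (1 + (st a).size + (st b).size + (st m).size +
        (powModVal (st a) (st b) (st m)).size) ∧
      (Prog.powMod d a b m).result O st s =
        PMF.pure (Function.update st d (powModVal (st a) (st b) (st m)), s) :=
  runs_of_coupled (runs_pay _ _ _ le_rfl)

theorem uniformBelow_eq (N : ℕ) [NeZero N] :
    uniformBelow N = (PMF.uniformOfFintype (Fin N)).map Fin.val := by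
  cases N with
  | zero => exact absurd rfl (NeZero.ne 0)
  | succ N => rfl

theorem le_of_mem_support_uniformBelow {N v : ℕ} (h : v ∈ (uniformBelow N).support) : v ≤ N := by
  cases N with
  | zero => exact (show v = 0 by simpa [uniformBelow] using h).le
  | succ N =>
    obtain ⟨x, -, rfl⟩ := (PMF.mem_support_map_iff _ _ _).1 h
    exact x.2.le

theorem runs_rand (O : Peer σ) (st : Store) (s : σ) (d a : ℕ) :
    (Prog.rand d a).HaltsWithin O st s (1 + (st a).size + (st a).size) ∧
      (Prog.rand d a).result O st s =
        (uniformBelow (st a)).map fun v => (Function.update st d v, s) := by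
  refine runs_of_coupled (PMF.Coupled.map (R := fun v w => v = w ∧ v ≤ st a)
    (.refl fun v hv => ⟨rfl, le_of_mem_support_uniformBelow hv⟩) ?_)
  rintro v _ ⟨rfl, hv⟩
  have := Nat.size_le_size hv
  rw [Conf.write, Conf.pay, if_pos (by simp only; omega)]
  exact ⟨_, rfl, rfl, Nat.zero_le _⟩

/-! ### Simulation within a stated cost -/

/-- The program halts within cost `T`, and its outcome can be coupled with `μ` along `R`. -/
def Simulates {α : Type} (P : Prog) (O : Peer σ) (st : Store) (s : σ) (T : ℕ) (μ : PMF α)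
    (R : α → Store → σ → Prop) : Prop :=
  ∀ e, PMF.Coupled (fun a o => ∃ c, o = some c ∧ R a c.store c.peer ∧ e ≤ c.fuel) μ
    (P.eval O ⟨st, s, T + e⟩)

section Simulates

variable {α β : Type} {μ : PMF α} {R : α → Store → σ → Prop}

theorem HaltsWithin.simulates (h : P.HaltsWithin O st s T) :
    P.Simulates O st s T (P.result O st s) fun out S t => (S, t) = out := fun e =>
  (h.coupled_result e).mono fun _ _ ⟨c, h1, h2, h3⟩ => ⟨c, h1, h2, h3⟩

theorem Simulates.haltsWithin (h : P.Simulates O st s T μ R) : P.HaltsWithin O st s T := by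
  intro hn
  obtain ⟨_, -, c, hc, -⟩ := (h 0).exists_left hn
  cases hc

theorem Simulates.coupled (h : P.Simulates O st s T μ R) :
    PMF.Coupled (fun a out => R a out.1 out.2) μ (P.result O st s) := by
  rw [h.haltsWithin.result_eq]
  conv => arg 2; rw [← PMF.map_id μ]
  refine (h 0).map ?_
  rintro a _ ⟨c, rfl, hR, -⟩
  exact hR

theorem Simulates.mono {R' : α → Store → σ → Prop} (h : P.Simulates O st s T μ R)
    (hT : T ≤ T') (hR : ∀ a S t, R a S t → R' a S t) : P.Simulates O st s T' μ R' := by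
  obtain ⟨k, rfl⟩ := Nat.exists_eq_add_of_le hT
  intro e
  rw [add_assoc]
  refine (h (k + e)).mono ?_
  rintro a _ ⟨c, rfl, h1, h2⟩
  exact ⟨c, rfl, hR _ _ _ h1, by omega⟩

theorem Simulates.and_support (h : P.Simulates O st s T μ R) :
    P.Simulates O st s T μ fun a S t => R a S t ∧ a ∈ μ.support := fun e =>
  (h e).mono_support fun _ ha _ _ ⟨c, h1, h2, h3⟩ => ⟨c, h1, ⟨h2, ha⟩, h3⟩

theorem Simulates.map {R' : β → Store → σ → Prop} {f : α → β} (h : P.Simulates O st s T μ R)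
    (hR : ∀ a S t, R a S t → R' (f a) S t) : P.Simulates O st s T (μ.map f) R' := by
  intro e
  rw [← PMF.map_id (eval _ _ _)]
  exact (h e).map fun _ _ ⟨c, h1, h2, h3⟩ => ⟨c, h1, hR _ _ _ h2, h3⟩

theorem simulates_of_runs {S : Store} (hR : ∀ out ∈ (P.result O st s).support, out = (S, s))
    (h : P.HaltsWithin O st s T) :
    P.Simulates O st s T (PMF.pure ()) fun _ S' t => S' = S ∧ t = s := by
  intro e
  have := h.simulates.and_support.map (f := fun _ => ()) (R' := fun _ S' t => S' = S ∧ t = s) (by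
    rintro out S' t ⟨rfl, hout⟩
    simpa using hR _ hout) e
  rwa [show PMF.map (fun _ => ()) (P.result O st s) = PMF.pure () from PMF.map_const _ _] at this

/-- Costs add because `Simulates` allows an arbitrary reserve: the first program is run with reserve
`T₂ + e`, which the second one can spend. -/
theorem Simulates.seq {f : α → PMF β} {R' : β → Store → σ → Prop} {T₁ T₂ : ℕ}
    (hP : P.Simulates O st s T₁ μ R)
    (hQ : ∀ a S t, R a S t → Q.Simulates O S t T₂ (f a) R') :
    (P.seq Q).Simulates O st s (T₁ + T₂) (μ.bind f) R' := by
  intro e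
  rw [add_assoc]
  refine (hP (T₂ + e)).bind ?_
  rintro a _ ⟨c, rfl, hR, he⟩
  obtain ⟨k, hk⟩ := Nat.exists_eq_add_of_le he
  have := (hQ a _ _ hR (e + k)).mono
    (R' := fun b o => ∃ c, o = some c ∧ R' b c.store c.peer ∧ e ≤ c.fuel) (by
      rintro b _ ⟨c, rfl, h1, h2⟩
      exact ⟨c, rfl, h1, by omega⟩)
  rwa [← add_assoc, ← hk] at this

end Simulates

theorem HaltsWithin.embed {C : ℕ} {R : Store → σ → Store → τ → Prop} {ρ : ℕ → ℕ}
    {f : ℕ → ℕ → Prog} {S : Store} {s' : τ} (h : P.HaltsWithin O st s T) (hC : 1 ≤ C)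
    (hread : ∀ st s S s', R st s S s' → ∀ a, S (ρ a) = st a)
    (hwrite : ∀ st s S s', R st s S s' → ∀ d v,
      R (Function.update st d v) s (Function.update S (ρ d) v) s')
    (hcall : ∀ e d a c c', Conf.Rel C e T R c c' → PMF.Coupled (OptRel (Conf.Rel C e T R))
      ((Prog.call d a).eval O c) ((f d a).eval O' c')) (hS : R st s S s') :
    (P.embed ρ f).Simulates O' S s' (C * T) (P.result O st s) fun out => R out.1 out.2 := by
  intro e
  have key := coupled_embed hC hread hwrite (hcall e) P ⟨st, s, T⟩ ⟨S, s', C * T + e⟩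
    ⟨hS, le_rfl, le_rfl⟩
  have key := key.mono_support (R' := fun o o' => ∃ c c', o = some c ∧ o' = some c' ∧
    R c.store c.peer c'.store c'.peer ∧ e ≤ c'.fuel) fun o ho o' _ hR => by
      cases o with
      | none => exact absurd ho h
      | some c =>
        obtain ⟨y, hy, h1, -, h2⟩ := hR c rfl
        exact ⟨c, y, rfl, hy, h1, by omega⟩
  rw [h.result_eq]
  conv => arg 3; rw [← PMF.map_id (eval _ _ _)]
  refine key.map ?_
  rintro _ _ ⟨c, c', rfl, rfl, hR⟩
  exact ⟨c', rfl, hR⟩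

/-! ### The registers a program can change -/

/-- The registers to which a program may write. -/
def writes : Prog → Finset ℕ
  | .skip => ∅
  | .const d _ => {d}
  | .arith _ d _ _ => {d}
  | .powMod d _ _ _ => {d}
  | .rand d _ => {d}
  | .call d _ => {d}
  | .seq P Q => P.writes ∪ Q.writes
  | .cond _ P Q => P.writes ∪ Q.writes
  | .loop _ P => P.writes

/-- From `c` to `c'` only registers in `W` changed, the new contents have been paid for, and the
invariant `I` of the partner is kept. -/
def Changed (I : σ → Prop) (W : Finset ℕ) (c c' : Conf σ) : Prop :=
  (I c.peer → I c'.peer) ∧ c'.fuel ≤ c.fuel ∧ ∀ k, c'.store k = c.store k ∨ (k ∈ W ∧ (c'.store k).size ≤ c.fuel)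

variable {I : σ → Prop}

theorem Changed.trans {W W' V : Finset ℕ} {c c' c'' : Conf σ} (h : Changed I W c c')
    (h' : Changed I W' c' c'') (hW : W ⊆ V) (hW' : W' ⊆ V) : Changed I V c c'' := by
  refine ⟨h'.1 ∘ h.1, h'.2.1.trans h.2.1, fun k => ?_⟩
  rcases h'.2.2 k with h2 | ⟨h2, h3⟩
  · rcases h.2.2 k with h4 | ⟨h4, h5⟩
    · exact .inl (h2.trans h4)
    · exact .inr ⟨hW h4, by rw [h2]; exact h5⟩
  · exact .inr ⟨hW' h2, h3.trans h.2.1⟩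

theorem changed_pay {W : Finset ℕ} {c c' : Conf σ} {k : ℕ} (h : c.pay k = some c') :
    Changed I W c c' := by
  unfold Conf.pay at h
  split_ifs at h
  cases h
  exact ⟨id, Nat.sub_le _ _, fun _ => .inl rfl⟩

theorem changed_write {c c' : Conf σ} {k d v : ℕ} (h : c.write k d v = some c') :
    Changed I {d} c c' := by
  unfold Conf.write Conf.pay at h
  split_ifs at h with hle
  cases h
  simp only at hle
  refine ⟨id, Nat.sub_le _ _, fun j => ?_⟩
  by_cases hj : j = d
  · subst hj
    exact .inr ⟨by simp, by simp; omega⟩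
  · exact .inl (by simp [hj])

theorem exists_of_mem_support_andThen {μ : PMF (Option (Conf σ))}
    {f : Conf σ → PMF (Option (Conf σ))} {c : Conf σ} (h : some c ∈ (andThen μ f).support) :
    ∃ c₁, some c₁ ∈ μ.support ∧ some c ∈ (f c₁).support := by
  obtain ⟨o, ho, hc⟩ := (PMF.mem_support_bind_iff _ _ _).1 h
  cases o with
  | none => simp at hc
  | some c₁ => exact ⟨c₁, ho, hc⟩

/-- Writing a number costs its length, so the budget bounds the size of everything a program leaves
behind. This is what makes polynomial bounds compose. -/
theorem changed_eval {O : Peer σ} (hI : ∀ t m, I t → ∀ out ∈ (O t m).support, I out.2) (P : Prog) :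
    ∀ c c', some c' ∈ (P.eval O c).support → Changed I P.writes c c' := by
  induction P with
  | skip => exact fun c c' h => changed_pay (Eq.symm (by simpa [eval] using h))
  | const d v => exact fun c c' h => changed_write (Eq.symm (by simpa [eval] using h))
  | arith op d a b => exact fun c c' h => changed_write (Eq.symm (by simpa [eval] using h))
  | powMod d a b m => exact fun c c' h => changed_write (Eq.symm (by simpa [eval] using h))
  | rand d a =>
    intro c c' h
    obtain ⟨v, -, hv⟩ := (PMF.mem_support_map_iff _ _ _).1 h
    exact changed_write hv
  | call d a =>
    intro c c' h
    obtain ⟨v, hv, h⟩ := (PMF.mem_support_map_iff _ _ _).1 h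
    have := changed_write (I := I) (c := { c with peer := v.2 }) h
    exact ⟨fun h => this.1 (hI _ _ h _ hv), this.2⟩
  | seq P Q ihP ihQ =>
    intro c c' h
    obtain ⟨c₁, h₁, h₂⟩ := exists_of_mem_support_andThen h
    exact (ihP _ _ h₁).trans (ihQ _ _ h₂) Finset.subset_union_left Finset.subset_union_right
  | cond a P Q ihP ihQ =>
    intro c c' h
    obtain ⟨c₁, h₁, h₂⟩ := exists_of_mem_support_andThen h
    have h₁ : Changed I ∅ c c₁ := changed_pay (Eq.symm (by simpa using h₁))
    split_ifs at h₂
    · exact h₁.trans (ihQ _ _ h₂) (Finset.empty_subset _) Finset.subset_union_right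
    · exact h₁.trans (ihP _ _ h₂) (Finset.empty_subset _) Finset.subset_union_left
  | loop a P ih =>
    intro c
    have key : ∀ k c c', some c' ∈ (loopEval a (P.eval O) k c).support →
        Changed I P.writes c c' := by
      intro k
      induction k with
      | zero => intro c c' h; simp [loopEval] at h
      | succ k ihk =>
        intro c c' h
        obtain ⟨c₁, h₁, h₂⟩ := exists_of_mem_support_andThen h
        have h₁ : Changed I P.writes c c₁ := changed_pay (Eq.symm (by simpa using h₁))
        split_ifs at h₂
        · simp only [PMF.mem_support_pure_iff, Option.some.injEq] at h₂
          rwa [h₂]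
        · obtain ⟨c₂, h₂, h₃⟩ := exists_of_mem_support_andThen h₂
          exact h₁.trans ((ih _ _ h₂).trans (ihk _ _ h₃) subset_rfl subset_rfl)
            subset_rfl subset_rfl
    exact key _ c

theorem HaltsWithin.changed (h : P.HaltsWithin O st s T)
    (hI : ∀ t m, I t → ∀ out ∈ (O t m).support, I out.2) {out : Store × σ}
    (hout : out ∈ (P.result O st s).support) :
    (I s → I out.2) ∧ ∀ k, out.1 k = st k ∨ (k ∈ P.writes ∧ (out.1 k).size ≤ T) := by
  rw [h.result_eq] at hout
  obtain ⟨o, ho, rfl⟩ := (PMF.mem_support_map_iff _ _ _).1 hout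
  cases o with
  | none => exact absurd ho h
  | some c => exact ⟨(changed_eval hI P _ _ ho).1, (changed_eval hI P _ _ ho).2.2⟩

theorem HaltsWithin.of_seq (h : (P.seq Q).HaltsWithin O st s T) :
    P.HaltsWithin O st s T ∧ (∀ out ∈ (P.result O st s).support, Q.HaltsWithin O out.1 out.2 T) ∧
      (P.seq Q).result O st s = (P.result O st s).bind fun out => Q.result O out.1 out.2 := by
  have hP : P.HaltsWithin O st s T := fun hn =>
    h ((PMF.mem_support_bind_iff _ _ _).2 ⟨none, hn, by simp⟩)
  have hQ : ∀ out ∈ (P.result O st s).support, Q.HaltsWithin O out.1 out.2 T := by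
    intro out hout
    rw [hP.result_eq] at hout
    obtain ⟨o, ho, rfl⟩ := (PMF.mem_support_map_iff _ _ _).1 hout
    cases o with
    | none => exact absurd ho hP
    | some c =>
      have hc : Q.HaltsWithin O c.store c.peer c.fuel := fun hn =>
        h ((PMF.mem_support_bind_iff _ _ _).2 ⟨some c, ho, hn⟩)
      exact hc.mono (changed_eval (I := fun _ => True) (fun _ _ _ _ _ => trivial) P _ _ ho).2.1
  exact ⟨hP, hQ, (hP.runs_seq hQ).2⟩

end Prog

/-! ### Embedded programs -/

theorem update_apply_of_injective {ρ : ℕ → ℕ} (hρ : Function.Injective ρ) {S st : Store}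
    (h : ∀ k, S (ρ k) = st k) (d v k : ℕ) :
    Function.update S (ρ d) v (ρ k) = Function.update st d v k := by
  simp only [Function.update_apply, hρ.eq_iff, h]

theorem update_apply_of_disjoint {ρ ρ' : ℕ → ℕ} (hρ : ∀ j k, ρ j ≠ ρ' k) (S : Store)
    (d v k : ℕ) : Function.update S (ρ d) v (ρ' k) = S (ρ' k) :=
  Function.update_of_ne (hρ d k).symm _ _

namespace Prog

variable {σ τ : Type} {O : Peer σ} {O' : Peer τ} {P Q : Prog} {st : Store} {s : σ} {T T' : ℕ}

/-- `d := a`, for different registers -/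
def copy (d a : ℕ) : Prog := (const d 0).seq (arith .add d d a)

theorem runs_copy (O : Peer σ) (st : Store) (s : σ) {d a : ℕ} (h : d ≠ a) :
    (copy d a).HaltsWithin O st s (2 + 2 * (st a).size) ∧
      (copy d a).result O st s = PMF.pure (Function.update st d (st a), s) := by
  have h1 := runs_const O st s d 0
  have h2 := runs_arith O (Function.update st d 0) s .add d d a
  simp only [Function.update_self, Function.update_of_ne h.symm, ArithOp.apply, zero_add,
    Nat.size_zero, Function.update_idem] at h2
  have := h1.1.runs_seq (Q := arith .add d d a) (T₂ := 1 + 2 * (st a).size) (by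
    rw [h1.2]
    simp only [PMF.mem_support_pure_iff, forall_eq]
    exact h2.1.mono (by omega))
  rw [h1.2, PMF.pure_bind, h2.2] at this
  exact ⟨this.1.mono (by simp; omega), this.2⟩

theorem simulates_copy (O : Peer σ) (st : Store) (s : σ) {d a : ℕ} (h : d ≠ a) :
    (copy d a).Simulates O st s (2 + 2 * (st a).size) (PMF.pure ())
      fun _ S t => S = Function.update st d (st a) ∧ t = s :=
  simulates_of_runs (by rw [(runs_copy O st s h).2]; simp) (runs_copy O st s h).1

/-- What becomes of the communication of a program that runs without a partner. -/
def noCall (ρ : ℕ → ℕ) (d _a : ℕ) : Prog := const (ρ d) 0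

/-- `noPeer` always replies `0`, so writing `0` reproduces a call, and no more expensively. The
actual partner and the registers outside the range of `ρ` stay untouched, which allows several
programs to share one store. -/
theorem HaltsWithin.embed_noCall {ρ : ℕ → ℕ} {S₀ : Store} {s' : τ}
    (h : P.HaltsWithin noPeer st () T) (hρ : Function.Injective ρ) (hS : ∀ k, S₀ (ρ k) = st k) :
    (P.embed ρ (noCall ρ)).Simulates O' S₀ s' T (P.result noPeer st ()) fun out S t =>
      (∀ k, S (ρ k) = out.1 k) ∧ (∀ x, (∀ k, x ≠ ρ k) → S x = S₀ x) ∧ t = s' := by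
  have := h.embed (O' := O') (C := 1) (ρ := ρ) (f := noCall ρ) (S := S₀) (s' := s')
    (R := fun st _ S t => (∀ k, S (ρ k) = st k) ∧ (∀ x, (∀ k, x ≠ ρ k) → S x = S₀ x) ∧ t = s')
    le_rfl (fun _ _ _ _ h => h.1)
    (fun st _ S t h d v => ⟨update_apply_of_injective hρ h.1 d v, fun x hx => by
      rw [Function.update_of_ne (hx d), h.2.1 x hx], h.2.2⟩)
    (by
      intro e d a c c' h
      simp only [eval, noPeer, noCall, PMF.pure_map]
      refine .pure (OptRel.write (c := { c with peer := () }) h ⟨?_, ?_, h.1.2.2⟩ (by simp))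
      · exact update_apply_of_injective hρ h.1.1 d 0
      · intro x hx
        rw [Function.update_of_ne (hx d), h.1.2.1 x hx])
    ⟨hS, fun _ _ => rfl, rfl⟩
  exact this.mono (by omega) fun _ _ _ h => h

/-- Communication of a program with renamed registers. -/
def forwardCall (ρ : ℕ → ℕ) (d a : ℕ) : Prog := call (ρ d) (ρ a)

theorem HaltsWithin.embed_forwardCall {ρ : ℕ → ℕ} {S : Store}
    (h : P.HaltsWithin O st s T) (hρ : Function.Injective ρ) (hS : ∀ k, S (ρ k) = st k) :
    (P.embed ρ (forwardCall ρ)).Simulates O S s T (P.result O st s) fun out S _ =>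
      ∀ k, S (ρ k) = out.1 k := by
  have := h.embed (O' := O) (C := 1) (ρ := ρ) (f := forwardCall ρ) (S := S) (s' := s)
    (R := fun st s S t => (∀ k, S (ρ k) = st k) ∧ t = s)
    le_rfl (fun _ _ _ _ h => h.1)
    (fun st _ S t h d v => ⟨update_apply_of_injective hρ h.1 d v, h.2⟩)
    (by
      intro e d a c c' h
      simp only [eval, forwardCall, h.1.1, h.1.2]
      refine PMF.Coupled.map (R := (· = ·)) (.refl fun _ _ => rfl) ?_
      rintro v _ rfl
      have h' : Conf.Rel 1 e T (fun st s S t => (∀ k, S (ρ k) = st k) ∧ t = s)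
        { c with peer := v.2 } { c' with peer := v.2 } := ⟨⟨h.1.1, rfl⟩, h.2⟩
      exact OptRel.write h' ⟨update_apply_of_injective hρ h.1.1 d v.1, rfl⟩ (by simp))
    ⟨hS, rfl⟩
  exact this.mono (by omega) fun _ _ _ h => h.1

/-- The communication partner that runs `Q` once for every message, which it finds in register `0`,
where it leaves its reply. -/
noncomputable def toPeer (Q : Prog) : Peer Store := fun st m =>
  (Q.result noPeer (Function.update st 0 m) ()).map fun out => (out.1 0, out.1)

/-- Communication with `Q.toPeer`, whose registers are renamed by `ρ'`. -/
def inlineCall (ρ ρ' : ℕ → ℕ) (Q : Prog) (d a : ℕ) : Prog :=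
  (copy (ρ' 0) (ρ a)).seq ((Q.embed ρ' (noCall ρ')).seq (copy (ρ d) (ρ' 0)))

/-- In a state with the invariant `I`, the program `Q` answers messages of at most `K` bits within
cost `T` by at most `M` bits. -/
def Answers (Q : Prog) (K T M : ℕ) (I : Store → Prop) : Prop :=
  ∀ st, I st → ∀ m < 2 ^ K, Q.HaltsWithin noPeer (Function.update st 0 m) () T ∧
    ∀ out ∈ (Q.toPeer st m).support, out.1 < 2 ^ M ∧ I out.2

/-- The cost is `T₀` for the answer, `2 + 2 * K` for copying the message in, and `2 + 2 * M` for
copying the reply out. -/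
theorem simulates_inlineCall {ρ ρ' : ℕ → ℕ} {K T₀ M : ℕ} {I : Store → Prop} {t S : Store}
    {s' : τ} (hρ : Function.Injective ρ) (hρ' : Function.Injective ρ') (hdis : ∀ j k, ρ j ≠ ρ' k)
    (hQ : Q.Answers K T₀ M I) (hst : ∀ k, S (ρ k) = st k) (ht : ∀ k, S (ρ' k) = t k) (hI : I t)
    (d a : ℕ) (ha : st a < 2 ^ K) :
    (inlineCall ρ ρ' Q d a).Simulates O' S s' (T₀ + 2 * K + 2 * M + 4) (Q.toPeer t (st a))
      fun out S _ => (∀ k, S (ρ k) = Function.update st d out.1 k) ∧ (∀ k, S (ρ' k) = out.2 k) ∧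
        I out.2 := by
  have hm : ∀ {m}, m < 2 ^ K → m.size ≤ K := Nat.size_le.2
  have h2 : ∀ S₁ s₁, S₁ = Function.update S (ρ' 0) (S (ρ a)) ∧ s₁ = s' →
      (Q.embed ρ' (noCall ρ')).Simulates O' S₁ s₁ T₀
        (Q.result noPeer (Function.update t 0 (st a)) ())
        fun out S _ => ((∀ k, S (ρ' k) = out.1 k) ∧ (∀ k, S (ρ k) = st k)) ∧
          out ∈ (Q.result noPeer (Function.update t 0 (st a)) ()).support := by
    rintro _ _ ⟨rfl, rfl⟩
    refine (((hQ t hI _ ha).1.embed_noCall hρ' ?_).mono le_rfl ?_).and_support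
    · intro k
      rw [hst]
      exact update_apply_of_injective hρ' ht 0 (st a) k
    · rintro out S₁ _ ⟨h1, h2, -⟩
      refine ⟨h1, fun k => ?_⟩
      rw [h2 _ (hdis k), Function.update_of_ne (hdis k 0), hst]
  have h3 : ∀ (out : Store × Unit) S₁ (s₁ : τ),
      ((∀ k, S₁ (ρ' k) = out.1 k) ∧ (∀ k, S₁ (ρ k) = st k)) ∧
        out ∈ (Q.result noPeer (Function.update t 0 (st a)) ()).support →
      (copy (ρ d) (ρ' 0)).Simulates O' S₁ s₁ (2 + 2 * M) (PMF.pure (out.1 0, out.1))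
        fun out S _ => (∀ k, S (ρ k) = Function.update st d out.1 k) ∧ (∀ k, S (ρ' k) = out.2 k) ∧
          I out.2 := by
    rintro out S₁ s₁ ⟨⟨h1, h2⟩, hout⟩
    have hb := (hQ t hI _ ha).2 (out.1 0, out.1)
      ((PMF.mem_support_map_iff _ _ _).2 ⟨out, hout, rfl⟩)
    have := (simulates_copy O' S₁ s₁ (hdis d 0)).map (f := fun _ => (out.1 0, out.1))
      (R' := fun out S _ => (∀ k, S (ρ k) = Function.update st d out.1 k) ∧
        (∀ k, S (ρ' k) = out.2 k) ∧ I out.2) (by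
        rintro - S₂ - ⟨rfl, -⟩
        refine ⟨fun k => ?_, fun k => ?_, hb.2⟩
        · rw [h1]
          exact update_apply_of_injective hρ h2 d (out.1 0) k
        · rw [update_apply_of_disjoint hdis, h1])
    rw [PMF.pure_map] at this
    refine this.mono ?_ fun _ _ _ h => h
    have := Nat.size_le.2 hb.1
    rw [h1]
    simp only at this
    omega
  have := (simulates_copy O' S s' (hdis a 0).symm).seq fun _ S₁ s₁ h => (h2 S₁ s₁ h).seq h3
  rw [PMF.pure_bind] at this
  refine this.mono ?_ fun _ _ _ h => h
  have := hm ha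
  rw [hst]
  omega

/-- `P` pays for the length of each message, so messages have at most `T` bits and the bound for `Q`
applies with `K = T`. Each call costs `P` at least one unit, worth `C` on the right, which is the
price of one inlined answer. -/
theorem HaltsWithin.embed_inlineCall {ρ ρ' : ℕ → ℕ} {T₀ M : ℕ} {I : Store → Prop} {t S : Store}
    {s' : τ} (h : P.HaltsWithin Q.toPeer st t T) (hρ : Function.Injective ρ)
    (hρ' : Function.Injective ρ') (hdis : ∀ j k, ρ j ≠ ρ' k) (hQ : Q.Answers T T₀ M I)
    (hst : ∀ k, S (ρ k) = st k) (ht : ∀ k, S (ρ' k) = t k) (hI : I t) :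
    (P.embed ρ (inlineCall ρ ρ' Q)).Simulates O' S s' ((T₀ + 2 * T + 2 * M + 4) * T)
      (P.result Q.toPeer st t) fun out S _ => ∀ k, S (ρ k) = out.1 k := by
  set C := T₀ + 2 * T + 2 * M + 4
  have := h.embed (O' := O') (C := C) (ρ := ρ) (f := inlineCall ρ ρ' Q) (S := S) (s' := s')
    (R := fun st t S _ => (∀ k, S (ρ k) = st k) ∧ (∀ k, S (ρ' k) = t k) ∧ I t)
    (by omega) (fun _ _ _ _ h => h.1)
    (fun st _ S t h d v => ⟨update_apply_of_injective hρ h.1 d v, fun k => by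
      rw [update_apply_of_disjoint hdis, h.2.1], h.2.2⟩)
    (by
      rintro e d a c c' ⟨⟨h1, h2, h3⟩, h4, h5⟩
      -- If `P` cannot pay for sending the message, its run ends in `none` and nothing has to be
      -- matched; otherwise the message is short enough for `hQ`.
      by_cases hsize : 1 + (c.store a).size ≤ c.fuel
      · have hfuel : C * c.fuel = C + C * (c.fuel - 1) := by
          obtain ⟨f, hf⟩ : ∃ f, c.fuel = f + 1 := ⟨c.fuel - 1, by omega⟩
          rw [hf, Nat.add_sub_cancel]; ring
        obtain ⟨k, hk⟩ : ∃ k, c'.fuel = C + k := ⟨c'.fuel - C, by omega⟩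
        have := simulates_inlineCall (O' := O') (s' := c'.peer) hρ hρ' hdis hQ h1 h2 h3 d a
          (Nat.size_le.1 (by omega)) k
        rw [← hk] at this
        rw [← PMF.map_id (eval O' _ c')]
        refine this.map ?_
        rintro out _ ⟨c₁, rfl, hR, hk'⟩ x hx
        unfold Conf.write Conf.pay at hx
        split_ifs at hx with hle
        cases hx
        refine ⟨_, rfl, hR, ?_, ?_⟩
        · simp only; omega
        · have : C * (c.fuel - (1 + (c.store a).size + out.1.size)) ≤ C * (c.fuel - 1) :=
            Nat.mul_le_mul_left _ (by omega)
          simp only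
          omega
      · refine .of_left fun o ho o' x hx => ?_
        obtain ⟨out, -, rfl⟩ := (PMF.mem_support_map_iff _ _ _).1 ho
        unfold Conf.write Conf.pay at hx
        rw [if_neg (by simp only; omega)] at hx
        cases hx)
    ⟨hst, ht, hI⟩
  exact this.mono le_rfl fun _ _ _ h => h.1

end Prog

/-! ### Efficient programs -/

theorem Polynomial.eval_le_eval (p : Polynomial ℕ) {a b : ℕ} (h : a ≤ b) : p.eval a ≤ p.eval b := by
  simp only [Polynomial.eval_eq_sum, Polynomial.sum]
  gcongr

/-- `L` bounds the security parameter in register `0`, the lengths of the contents of all registers,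
and the number of registers in use. -/
def Store.Bounded (L : ℕ) (S : Store) : Prop :=
  S 0 ≤ L ∧ (∀ k, S k < 2 ^ L) ∧ ∀ k, L ≤ k → S k = 0

theorem Store.ofList_getElem_lt {l : List ℕ} {B : ℕ} (hB : 0 < B) (h : ∀ x ∈ l, x < B) (k : ℕ) :
    Store.ofList l k < B := by
  unfold Store.ofList
  by_cases hk : k < l.length
  · rw [List.getD_eq_getElem _ _ hk]; exact h _ (List.getElem_mem hk)
  · rwa [List.getD_eq_default _ _ (by omega)]

theorem Store.ofList_bounded {κ L : ℕ} {xs : List ℕ} (h : ∀ x ∈ xs, x < 2 ^ L) :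
    Store.Bounded (κ + xs.length + L + 1) (Store.ofList (κ :: xs)) := by
  refine ⟨?_, ?_, ?_⟩
  · simp [Store.ofList]; omega
  · refine Store.ofList_getElem_lt (by positivity) fun x hx => ?_
    rcases List.mem_cons.1 hx with rfl | hx
    · exact (Nat.lt_two_pow_self).trans_le (Nat.pow_le_pow_right (by norm_num) (by omega))
    · exact (h x hx).trans_le (Nat.pow_le_pow_right (by norm_num) (by omega))
  · intro k hk
    exact List.getD_eq_default _ _ (by simp; omega)

theorem Store.ofList_ofFn (S : Store) {L : ℕ} (h : ∀ k, L ≤ k → S k = 0) (k : ℕ) :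
    Store.ofList (List.ofFn fun j : Fin L => S j) k = S k := by
  unfold Store.ofList
  by_cases hk : k < L
  · rw [List.getD_eq_getElem _ _ (by simpa using hk)]; simp
  · rw [List.getD_eq_default _ _ (by simpa using hk), h k (by omega)]

theorem Store.ofList_cons (a : ℕ) (l : List ℕ) (S : Store) (h0 : S 0 = a)
    (h : ∀ k, S (k + 1) = Store.ofList l k) (k : ℕ) : S k = Store.ofList (a :: l) k := by
  cases k with
  | zero => simpa [Store.ofList] using h0
  | succ k => simpa [Store.ofList] using h k

theorem Store.exists_list {S : Store} {L M : ℕ} (hL : ∀ k, S k < 2 ^ M)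
    (h : ∀ k, L ≤ k → S k = 0) :
    ∃ l : List ℕ, l.length = L ∧ (∀ x ∈ l, x < 2 ^ M) ∧ ∀ k, Store.ofList l k = S k := by
  refine ⟨List.ofFn fun j : Fin L => S j, by simp, ?_, Store.ofList_ofFn S h⟩
  intro x hx
  obtain ⟨j, rfl⟩ := (List.mem_ofFn' _ _).1 hx
  exact hL _

/-- The states with the invariant `I` reply with at most `L` bits. -/
def PeerBounded {σ : Type} (L : ℕ) (O : Peer σ) (I : σ → Prop) : Prop :=
  ∀ t m, I t → ∀ out ∈ (O t m).support, out.1 < 2 ^ L ∧ I out.2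

theorem PeerBounded.mono {σ : Type} {L L' : ℕ} {O : Peer σ} {I : σ → Prop}
    (h : PeerBounded L O I) (hL : L ≤ L') : PeerBounded L' O I := fun t m ht out hout =>
  ⟨(h t m ht out hout).1.trans_le (Nat.pow_le_pow_right (by norm_num) hL), (h t m ht out hout).2⟩

namespace Prog

variable {P Q : Prog}

/-- The program halts within polynomial cost. -/
def Efficient (P : Prog) : Prop :=
  ∃ T : Polynomial ℕ, ∀ (L : ℕ) (S : Store), S.Bounded L → ∀ (σ : Type) (O : Peer σ) (s : σ)
    (I : σ → Prop), I s → PeerBounded L O I → P.HaltsWithin O S s (T.eval L)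

theorem Efficient.polyTime (h : P.Efficient) : P.PolyTime := by
  obtain ⟨T, hT⟩ := h
  refine ⟨T.comp (Polynomial.X + 1), fun κ L xs σ O s I hxs hs hO => ?_⟩
  rw [Polynomial.eval_comp]
  simp only [Polynomial.eval_add, Polynomial.eval_X, Polynomial.eval_one]
  exact hT _ _ (Store.ofList_bounded hxs) σ O s I hs (PeerBounded.mono hO (by omega))

/-- Register `0` is bounded by value rather than by length, since the security parameter counts in
unary. The first program must not overwrite it, as its output is only known to be short. -/
theorem Efficient.seq (hP : P.Efficient) (h0 : 0 ∉ P.writes) (hQ : Q.Efficient) :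
    (P.seq Q).Efficient := by
  obtain ⟨T₁, hT₁⟩ := hP
  obtain ⟨T₂, hT₂⟩ := hQ
  -- `w` exceeds every register that `P` can write, so registers beyond the new bound are still
  -- empty.
  set w := P.writes.sup id + 1
  refine ⟨T₁ + T₂.comp (Polynomial.X + T₁ + Polynomial.C w), fun L S hS σ O s I hs hO => ?_⟩
  simp only [Polynomial.eval_add, Polynomial.eval_comp, Polynomial.eval_X, Polynomial.eval_C]
  have h₁ := hT₁ L S hS σ O s I hs hO
  refine (h₁.runs_seq fun out hout => ?_).1
  obtain ⟨hI, hst⟩ := h₁.changed (I := I) (fun t m ht out h => (hO t m ht out h).2) hout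
  refine hT₂ _ _ ⟨?_, fun k => ?_, fun k hk => ?_⟩ σ O _ I (hI hs) (hO.mono (by omega))
  · rcases hst 0 with h | h
    · have := hS.1; omega
    · exact absurd h.1 h0
  · rcases hst k with h | h
    · rw [h]
      exact (hS.2.1 k).trans_le (Nat.pow_le_pow_right (by norm_num) (by omega))
    · exact Nat.size_le.1 (by omega)
  · rcases hst k with h | h
    · rw [h]
      exact hS.2.2 k (by omega)
    · have : id k ≤ P.writes.sup id := Finset.le_sup h.1
      simp only [id] at this
      omega

theorem efficient_of_bound (a : ℕ) (h : ∀ L S, Store.Bounded L S → ∀ (σ : Type) (O : Peer σ) (s : σ),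
    P.HaltsWithin O S s (a + 5 * L)) : P.Efficient := by
  refine ⟨Polynomial.C a + 5 * Polynomial.X, fun L S hS σ O s _ _ _ => ?_⟩
  simpa using h L S hS σ O s

theorem efficient_skip : skip.Efficient :=
  efficient_of_bound 1 fun _ _ _ _ _ _ => (runs_skip _ _ _).1.mono (by omega)

theorem efficient_const (d v : ℕ) : (const d v).Efficient :=
  efficient_of_bound (1 + v.size) fun _ _ _ _ _ _ => (runs_const _ _ _ _ _).1.mono (by omega)

theorem efficient_copy {d a : ℕ} (h : d ≠ a) : (copy d a).Efficient :=
  efficient_of_bound 2 fun _ S hS _ _ _ => (runs_copy _ _ _ h).1.mono (by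
    have := Nat.size_le.2 (hS.2.1 a); omega)

theorem efficient_rand (d a : ℕ) : (rand d a).Efficient :=
  efficient_of_bound 2 fun _ S hS _ _ _ => (runs_rand _ _ _ _ _).1.mono (by
    have := Nat.size_le.2 (hS.2.1 a); omega)

theorem efficient_powMod (d a b m : ℕ) : (powMod d a b m).Efficient :=
  efficient_of_bound 1 fun L S hS _ _ _ => (runs_powMod _ _ _ _ _ _ _).1.mono (by
    have ha := Nat.size_le.2 (hS.2.1 a)
    have hb := Nat.size_le.2 (hS.2.1 b)
    have hm := Nat.size_le.2 (hS.2.1 m)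
    have : powModVal (S a) (S b) (S m) ≤ S m := by
      unfold powModVal
      split_ifs
      · exact Nat.zero_le _
      · exact (Nat.mod_lt _ (by omega)).le
    have := Nat.size_le_size this
    omega)

theorem efficient_arith (op : ArithOp) (d a b : ℕ) : (arith op d a b).Efficient :=
  efficient_of_bound 2 fun L S hS _ _ _ => (runs_arith _ _ _ _ _ _ _).1.mono (by
    have ha := Nat.size_le.2 (hS.2.1 a)
    have hb := Nat.size_le.2 (hS.2.1 b)
    have : (op.apply (S a) (S b)).size ≤ 2 * L + 1 := by
      have ha := hS.2.1 a
      have hb := hS.2.1 b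
      have h1 : 1 ≤ 2 ^ L := Nat.one_le_two_pow
      have h2 : 2 ^ (2 * L + 1) = 2 ^ L * 2 ^ L * 2 := by ring
      rw [Nat.size_le, h2]
      have h3 : 2 ^ L ≤ 2 ^ L * 2 ^ L := Nat.le_mul_of_pos_left _ (by positivity)
      cases op with
      | add => simp only [ArithOp.apply]; omega
      | sub => simp only [ArithOp.apply]; omega
      | mul =>
        have : S a * S b ≤ 2 ^ L * 2 ^ L := Nat.mul_le_mul ha.le hb.le
        simp only [ArithOp.apply]; omega
      | div => have := Nat.div_le_self (S a) (S b); simp only [ArithOp.apply]; omega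
      | mod => have := Nat.mod_le (S a) (S b); simp only [ArithOp.apply]; omega
    omega)

/-- Run `P` with renamed registers for the security parameter in register `0`. -/
def embedAt (ρ : ℕ → ℕ) (f : ℕ → ℕ → Prog) (P : Prog) : Prog :=
  (copy (ρ 0) 0).seq (P.embed ρ f)

/-- A strictly increasing `ρ` satisfies `k ≤ ρ k`, so the renamed registers also vanish from index
`L` on and form a legitimate input list. -/
theorem exists_list_update {ρ : ℕ → ℕ} (hρ : StrictMono ρ) {S : Store} {L : ℕ} (hS : S.Bounded L) :
    ∃ xs : List ℕ, xs.length = L ∧ (∀ x ∈ xs, x < 2 ^ L) ∧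
      ∀ k, Function.update S (ρ 0) (S 0) (ρ k) = Store.ofList (S 0 :: xs) k := by
  obtain ⟨xs, h1, h2, h3⟩ := Store.exists_list (S := fun k => S (ρ (k + 1))) (L := L) (M := L)
    (fun k => hS.2.1 _) fun k hk => hS.2.2 _ (by have := hρ.le_apply (x := k + 1); omega)
  refine ⟨xs, h1, h2, Store.ofList_cons _ _ (fun k => Function.update S (ρ 0) (S 0) (ρ k))
    (by simp) fun k => ?_⟩
  rw [h3, Function.update_of_ne (hρ.injective.ne (by omega))]

theorem efficient_embedAt_noCall {ρ : ℕ → ℕ} (hρ : StrictMono ρ) (h0 : 0 < ρ 0) (hP : P.PolyTime) :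
    (embedAt ρ (noCall ρ) P).Efficient := by
  obtain ⟨T, hT⟩ := hP
  -- The first summands pay for copying the security parameter. The factor `3` arises because that
  -- parameter, the length of the list and the bit length are each at most `L`.
  refine ⟨2 + 2 * Polynomial.X + T.comp (3 * Polynomial.X), fun L S hS σ O s _ _ _ => ?_⟩
  simp only [Polynomial.eval_add, Polynomial.eval_comp, Polynomial.eval_mul, Polynomial.eval_X,
    Polynomial.eval_ofNat]
  have h1 := runs_copy O S s h0.ne'
  have hsize := Nat.size_le.2 (hS.2.1 0)
  refine ((h1.1.mono (T' := 2 + 2 * L) (by omega)).runs_seq ?_).1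
  rw [h1.2]
  simp only [PMF.mem_support_pure_iff, forall_eq]
  obtain ⟨xs, hlen, hxs, hS'⟩ := exists_list_update hρ hS
  have := hT (S 0) L xs Unit noPeer () (fun _ => True) hxs trivial (by simp [noPeer])
  exact ((this.mono (T.eval_le_eval (by have := hS.1; omega))).embed_noCall hρ.injective hS').haltsWithin

theorem efficient_embedAt_forwardCall {ρ : ℕ → ℕ} (hρ : StrictMono ρ) (h0 : 0 < ρ 0)
    (hP : P.PolyTime) : (embedAt ρ (forwardCall ρ) P).Efficient := by
  obtain ⟨T, hT⟩ := hP
  refine ⟨2 + 2 * Polynomial.X + T.comp (3 * Polynomial.X), fun L S hS σ O s I hs hO => ?_⟩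
  simp only [Polynomial.eval_add, Polynomial.eval_comp, Polynomial.eval_mul, Polynomial.eval_X,
    Polynomial.eval_ofNat]
  have h1 := runs_copy O S s h0.ne'
  have hsize := Nat.size_le.2 (hS.2.1 0)
  refine ((h1.1.mono (T' := 2 + 2 * L) (by omega)).runs_seq ?_).1
  rw [h1.2]
  simp only [PMF.mem_support_pure_iff, forall_eq]
  obtain ⟨xs, hlen, hxs, hS'⟩ := exists_list_update hρ hS
  have := hT (S 0) L xs σ O s I hxs hs hO
  exact ((this.mono (T.eval_le_eval (by have := hS.1; omega))).embed_forwardCall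
    hρ.injective hS').haltsWithin

end Prog

/-! ### Bounds for the receiver of the oblivious transfer -/

namespace OTProtocol

variable {ot : OTProtocol}

theorem Reachable.mono {K K' : ℕ} {st₀ st : Store} (h : ot.Reachable K st₀ st) (hK : K ≤ K') :
    ot.Reachable K' st₀ st := by
  induction h with
  | init => exact .init
  | step st m out _ hm hout ih =>
    exact .step st m out ih (hm.trans_le (Nat.pow_le_pow_right (by norm_num) hK)) hout

/-- The bound on replies is independent of the message length `K`, so it holds on the union over all
`K` of the reachable states. Every message has some length, so this union is never left. -/
theorem EfficientReceiver.peerBounded {N : ℕ} (h : ot.EfficientReceiver N) :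
    ∃ M : Polynomial ℕ, ∀ (κ L : ℕ) (xs : List ℕ) (r : Fin N), (∀ x ∈ xs, x < 2 ^ L) →
      PeerBounded (M.eval (κ + xs.length + L)) ot.receiverPeer
        fun st => ∃ K, ot.Reachable K (receiverInit (κ :: xs) r) st := by
  obtain ⟨T, M, h⟩ := h
  refine ⟨M, fun κ L xs r hxs st m ⟨K, hst⟩ out hout => ?_⟩
  have hm : m < 2 ^ max K m :=
    Nat.lt_two_pow_self.trans_le (Nat.pow_le_pow_right (by norm_num) (le_max_right _ _))
  have hst := hst.mono (le_max_left K m)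
  exact ⟨(h κ L _ xs r hxs st hst m hm).2 out hout, _, .step st m out hst hm hout⟩

theorem EfficientReceiver.answers {N : ℕ} (h : ot.EfficientReceiver N) :
    ∃ T M : Polynomial ℕ, ∀ (κ L K : ℕ) (xs : List ℕ) (r : Fin N), (∀ x ∈ xs, x < 2 ^ L) →
      ot.receiver.Answers K (T.eval (κ + xs.length + L + K)) (M.eval (κ + xs.length + L))
        (ot.Reachable K (receiverInit (κ :: xs) r)) := by
  obtain ⟨T, M, h⟩ := h
  refine ⟨T, M, fun κ L K xs r hxs st hst m hm => ?_⟩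
  obtain ⟨h1, h2⟩ := h κ L K xs r hxs st hst m hm
  exact ⟨h1, fun out hout => ⟨h2 out hout, .step st m out hst hm hout⟩⟩

end OTProtocol

/-! ### Running the receiver inside the adversary's program -/

namespace Prog

variable {σ : Type} {O : Peer σ} {P Q : Prog} {S st : Store} {s : σ} {T : ℕ}

theorem simulates_embedAt {α : Type} {μ : PMF α} {R : α → Store → σ → Prop} {ρ : ℕ → ℕ}
    {f : ℕ → ℕ → Prog} (hρ : Function.Injective ρ) (hρ0 : ρ 0 ≠ 0) (h0 : st 0 = S 0)
    (hst : ∀ k, 1 ≤ k → S (ρ k) = st k)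
    (h : ∀ S', (∀ k, S' (ρ k) = st k) → (∀ x, x ≠ ρ 0 → S' x = S x) →
      (P.embed ρ f).Simulates O S' s T μ R) :
    (embedAt ρ f P).Simulates O S s (2 + 2 * (S 0).size + T) μ R := by
  have := (simulates_copy O S s hρ0).seq (Q := P.embed ρ f) (f := fun _ => μ) (R' := R)
    (T₂ := T) (by
      rintro - _ _ ⟨rfl, rfl⟩
      refine h _ (fun k => ?_) fun x hx => Function.update_of_ne hx _ _
      by_cases hk : k = 0
      · rw [hk, Function.update_self, h0]
      · rw [Function.update_of_ne (hρ.ne hk), hst k (by omega)])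
  rwa [PMF.pure_bind] at this

/-- Run `P` with renamed registers, inlining its communication with `Q`, for the security parameter
in register `0`. The number `r` is the choice that is given to `Q`. -/
def inlineRun (ρ ρ' : ℕ → ℕ) (r : ℕ) (Q P : Prog) : Prog :=
  (const (ρ' 0) 0).seq ((const (ρ' 1) r).seq ((copy (ρ' 2) 0).seq
    (embedAt ρ (inlineCall ρ ρ' Q) P)))

/-- The receiver starts with `0`, its choice and the security parameter, which are written here; its
remaining common input must already be in place. The constant `6` collects two constant assignments
and two copies. -/
theorem simulates_inlineRun {ρ ρ' : ℕ → ℕ} {T₀ M r : ℕ} {I : Store → Prop} {t : Store}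
    (h : P.HaltsWithin Q.toPeer st t T) (hρ : Function.Injective ρ)
    (hρ' : Function.Injective ρ') (hdis : ∀ j k, ρ j ≠ ρ' k) (hρ0 : ∀ k, ρ k ≠ 0)
    (hρ0' : ∀ k, ρ' k ≠ 0) (hQ : Q.Answers T T₀ M I) (hI : I t) (hst0 : st 0 = S 0)
    (hst : ∀ k, 1 ≤ k → S (ρ k) = st k) (ht0 : t 0 = 0) (ht1 : t 1 = r) (ht2 : t 2 = S 0)
    (ht : ∀ k, 3 ≤ k → S (ρ' k) = t k) :
    (inlineRun ρ ρ' r Q P).Simulates O S s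
      (6 + r.size + 4 * (S 0).size + (T₀ + 2 * T + 2 * M + 4) * T)
      (P.result Q.toPeer st t) fun out S _ => ∀ k, S (ρ k) = out.1 k := by
  set S₁ := Function.update S (ρ' 0) 0 with hS₁
  set S₂ := Function.update S₁ (ρ' 1) r with hS₂
  set S₃ := Function.update S₂ (ρ' 2) (S₂ 0) with hS₃
  have hS₂0 : S₂ 0 = S 0 := by
    rw [hS₂, hS₁, Function.update_of_ne (hρ0' 1).symm, Function.update_of_ne (hρ0' 0).symm]
  have hS₃0 : S₃ 0 = S 0 := by rw [hS₃, Function.update_of_ne (hρ0' 2).symm, hS₂0]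
  have h1 : (const (ρ' 0) 0).Simulates O S s 1 (PMF.pure ()) fun _ S' t => S' = S₁ ∧ t = s :=
    simulates_of_runs (by rw [(runs_const O S s _ _).2]; simp [hS₁])
      ((runs_const O S s (ρ' 0) 0).1.mono (by simp))
  have h2 : (const (ρ' 1) r).Simulates O S₁ s (1 + r.size) (PMF.pure ())
      fun _ S' t => S' = S₂ ∧ t = s :=
    simulates_of_runs (by rw [(runs_const O S₁ s _ _).2]; simp [hS₂]) (runs_const O S₁ s (ρ' 1) r).1
  have h3 := simulates_copy O S₂ s (hρ0' 2)
  have h4 := simulates_embedAt (O := O) (S := S₃) (st := st) (s := s) (P := P)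
    (f := inlineCall ρ ρ' Q) (μ := P.result Q.toPeer st t) (T := (T₀ + 2 * T + 2 * M + 4) * T)
    (R := fun out S _ => ∀ k, S (ρ k) = out.1 k) hρ (hρ0 0) (by rw [hS₃0, hst0])
    (fun k hk => by
      rw [hS₃, Function.update_of_ne (hdis _ _), hS₂, Function.update_of_ne (hdis _ _), hS₁,
        Function.update_of_ne (hdis _ _), hst k hk])
    (fun S' h1 h2 => h.embed_inlineCall hρ hρ' hdis hQ h1 (fun k => by
      rw [h2 _ (hdis 0 k).symm]
      match k with
      | 0 => rw [hS₃, Function.update_of_ne (hρ'.ne (by omega)), hS₂,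
              Function.update_of_ne (hρ'.ne (by omega)), hS₁, Function.update_self, ht0]
      | 1 => rw [hS₃, Function.update_of_ne (hρ'.ne (by omega)), hS₂, Function.update_self, ht1]
      | 2 => rw [hS₃, Function.update_self, hS₂0, ht2]
      | k + 3 => rw [hS₃, Function.update_of_ne (hρ'.ne (by omega)), hS₂,
              Function.update_of_ne (hρ'.ne (by omega)), hS₁,
              Function.update_of_ne (hρ'.ne (by omega)), ht _ (by omega)]) hI)
  have := h1.seq (f := fun _ => P.result Q.toPeer st t) fun _ _ _ h => by
    rw [h.1, h.2, ← PMF.pure_bind () fun _ => P.result Q.toPeer st t]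
    exact h2.seq fun _ _ _ h => by
      rw [h.1, h.2, ← PMF.pure_bind () fun _ => P.result Q.toPeer st t]
      exact h3.seq fun _ _ _ h => by
        rw [h.1, h.2]
        exact h4
  rw [PMF.pure_bind] at this
  refine this.mono ?_ fun _ _ _ h => h
  rw [hS₂0, hS₃0]
  omega

/-- There is no circularity between the two running times. Replies are bounded in terms of the input
alone; this bounds the time of `P`, hence the length of its messages, and hence the time of the
receiver. -/
theorem efficient_inlineRun {ρ ρ' : ℕ → ℕ} {ot : OTProtocol} {N : ℕ} (hρ : StrictMono ρ)
    (hρ' : StrictMono ρ') (hdis : ∀ j k, ρ j ≠ ρ' k) (hρ0 : ∀ k, ρ k ≠ 0)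
    (hρ0' : ∀ k, ρ' k ≠ 0) (hP : P.PolyTime) (hot : ot.EfficientReceiver N) (r : Fin N) :
    (inlineRun ρ ρ' r ot.receiver P).Efficient := by
  obtain ⟨TP, hTP⟩ := hP
  obtain ⟨M, hM⟩ := hot.peerBounded
  obtain ⟨T₀, M', hT₀⟩ := hot.answers
  have poly : ∃ p : Polynomial ℕ, ∀ L, p.eval L = 6 + (r : ℕ).size + 4 * L +
      (T₀.eval (3 * L + TP.eval (3 * L + M.eval (3 * L))) + 2 * TP.eval (3 * L + M.eval (3 * L)) +
        2 * M'.eval (3 * L) + 4) * TP.eval (3 * L + M.eval (3 * L)) := by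
    set TQ := TP.comp (3 * Polynomial.X + M.comp (3 * Polynomial.X)) with hTQ
    have hTQ' : ∀ L, TQ.eval L = TP.eval (3 * L + M.eval (3 * L)) := fun L => by
      simp [hTQ, Polynomial.eval_comp]
    refine ⟨6 + Polynomial.C (r : ℕ).size + 4 * Polynomial.X +
      (T₀.comp (3 * Polynomial.X + TQ) + 2 * TQ + 2 * M'.comp (3 * Polynomial.X) + 4) * TQ,
      fun L => ?_⟩
    simp [Polynomial.eval_comp, hTQ']
  obtain ⟨p, hp⟩ := poly
  refine ⟨p, fun L S hS σ O s I _ _ => ?_⟩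
  rw [hp]
  have h0 := hS.1
  obtain ⟨xs, hx1, hx2, hx3⟩ := exists_list_update hρ hS
  obtain ⟨ys, hy1, hy2, hy3⟩ := Store.exists_list (S := fun k => S (ρ' (k + 3))) (L := L) (M := L)
    (fun k => hS.2.1 _) fun k hk => hS.2.2 _ (by have := hρ'.le_apply (x := k + 3); omega)
  have hO := (hM (S 0) L ys r hy2).mono (L' := L + M.eval (3 * L))
    ((M.eval_le_eval (by omega)).trans (Nat.le_add_left _ _))
  have h1 := (hTP (S 0) (L + M.eval (3 * L)) xs Store ot.receiverPeer
    (OTProtocol.receiverInit (S 0 :: ys) r) _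
    (fun x hx => (hx2 x hx).trans_le (Nat.pow_le_pow_right (by norm_num) (by omega)))
    ⟨0, .init⟩ hO).mono (T' := TP.eval (3 * L + M.eval (3 * L))) (TP.eval_le_eval (by omega))
  have h2 := hT₀ (S 0) L (TP.eval (3 * L + M.eval (3 * L))) ys r hy2
  have h3 := simulates_inlineRun (O := O) (s := s) (S := S) (r := r) h1 hρ.injective hρ'.injective hdis hρ0 hρ0'
    h2 .init (by simp [Store.ofList])
    (fun k hk => by rw [← hx3 k, Function.update_of_ne (hρ.injective.ne (by omega))])
    rfl rfl rfl (fun k hk => by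
      obtain ⟨k, rfl⟩ := Nat.exists_eq_add_of_le' hk
      rw [← hy3 k]
      simp [OTProtocol.receiverInit, Store.ofList])
  refine h3.haltsWithin.mono ?_
  have := Nat.size_le.2 (hS.2.1 0)
  have hT : T₀.eval (S 0 + ys.length + L + TP.eval (3 * L + M.eval (3 * L))) ≤
    T₀.eval (3 * L + TP.eval (3 * L + M.eval (3 * L))) := T₀.eval_le_eval (by omega)
  have hM : M'.eval (S 0 + ys.length + L) ≤ M'.eval (3 * L) := M'.eval_le_eval (by omega)
  gcongr

/-! ### Straight-line programs -/

/-- Deterministic programs without branching and communication. -/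
def Straight : Prog → Prop
  | .skip => True
  | .const _ _ => True
  | .arith _ _ _ _ => True
  | .powMod _ _ _ _ => True
  | .seq P Q => P.Straight ∧ Q.Straight
  | _ => False

/-- The effect of a straight-line program. -/
def step : Prog → Store → Store
  | .const d v, S => Function.update S d v
  | .arith op d a b, S => Function.update S d (op.apply (S a) (S b))
  | .powMod d a b m, S => Function.update S d (powModVal (S a) (S b) (S m))
  | .seq P Q, S => Q.step (P.step S)
  | _, S => S

/-- Sequential composition of a list of programs. -/
def seqs (l : List Prog) : Prog := l.foldr seq skip

theorem Straight.runs (h : P.Straight) (O : Peer σ) (S : Store) (s : σ) :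
    P.Halts O S s ∧ P.result O S s = PMF.pure (P.step S, s) := by
  induction P generalizing S with
  | skip => exact ⟨⟨_, (runs_skip O S s).1⟩, (runs_skip O S s).2⟩
  | const d v => exact ⟨⟨_, (runs_const O S s d v).1⟩, (runs_const O S s d v).2⟩
  | arith op d a b => exact ⟨⟨_, (runs_arith O S s op d a b).1⟩, (runs_arith O S s op d a b).2⟩
  | powMod d a b m => exact ⟨⟨_, (runs_powMod O S s d a b m).1⟩, (runs_powMod O S s d a b m).2⟩
  | seq P Q ihP ihQ =>
    obtain ⟨⟨T₁, h1⟩, h2⟩ := ihP h.1 S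
    obtain ⟨⟨T₂, h3⟩, h4⟩ := ihQ h.2 (P.step S)
    have := h1.runs_seq (Q := Q) (T₂ := T₂) (by rw [h2]; simpa using h3)
    exact ⟨⟨_, this.1⟩, by rw [this.2, h2, PMF.pure_bind, h4, step]⟩
  | _ => exact h.elim

theorem Straight.efficient (h : P.Straight) (h0 : 0 ∉ P.writes) : P.Efficient := by
  induction P with
  | skip => exact efficient_skip
  | const d v => exact efficient_const d v
  | arith op d a b => exact efficient_arith op d a b
  | powMod d a b m => exact efficient_powMod d a b m
  | seq P Q ihP ihQ =>
    simp only [writes, Finset.mem_union, not_or] at h0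
    exact (ihP h.1 h0.1).seq h0.1 (ihQ h.2 h0.2)
  | _ => exact h.elim

theorem step_of_notMem_writes (P : Prog) {k : ℕ} (h : k ∉ P.writes) (S : Store) :
    P.step S k = S k := by
  induction P generalizing S with
  | seq P Q ihP ihQ =>
    simp only [writes, Finset.mem_union, not_or] at h
    rw [step, ihQ h.2, ihP h.1]
  | const d v => exact Function.update_of_ne (by simpa [writes] using h) _ _
  | arith op d a b => exact Function.update_of_ne (by simpa [writes] using h) _ _
  | powMod d a b m => exact Function.update_of_ne (by simpa [writes] using h) _ _
  | _ => rfl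

theorem straight_copy (d a : ℕ) : (copy d a).Straight := ⟨trivial, trivial⟩

theorem step_copy {d a : ℕ} (h : d ≠ a) (S : Store) :
    (copy d a).step S = Function.update S d (S a) := by
  simp [copy, step, ArithOp.apply, Function.update_of_ne h.symm]

@[simp] theorem writes_copy (d a : ℕ) : (copy d a).writes = {d} := by simp [copy, writes]

theorem straight_seqs {l : List Prog} (h : ∀ P ∈ l, P.Straight) : (seqs l).Straight := by
  induction l with
  | nil => trivial
  | cons P l ih =>
    exact ⟨h P (by simp), ih fun Q hQ => h Q (by simp [hQ])⟩

theorem mem_writes_seqs {l : List Prog} {k : ℕ} :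
    k ∈ (seqs l).writes ↔ ∃ P ∈ l, k ∈ P.writes := by
  induction l with
  | nil => simp [seqs, writes]
  | cons P l ih => simpa [seqs, writes] using or_congr Iff.rfl ih

/-- The assignments read nothing that any of them writes, so each sees the initial values and none
disturbs another. -/
theorem step_seqs_map {ι : Type} {f : ι → Prog} {t : ι → ℕ} {v : ι → ℕ} {S₀ : Store}
    (ht : Function.Injective t)
    (hf : ∀ j S, (∀ x, (∀ j, x ≠ t j) → S x = S₀ x) → (f j).step S = Function.update S (t j) (v j))
    (l : List ι) : ∀ S, (∀ x, (∀ j, x ≠ t j) → S x = S₀ x) →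
      (∀ j ∈ l, (seqs (l.map f)).step S (t j) = v j) ∧
      ∀ x, (∀ j ∈ l, x ≠ t j) → (seqs (l.map f)).step S x = S x := by
  induction l with
  | nil => intro S _; simp [seqs, step]
  | cons i l ih =>
    intro S hS
    have hstep : (seqs ((i :: l).map f)).step S =
        (seqs (l.map f)).step (Function.update S (t i) (v i)) := by
      rw [← hf i S hS]; rfl
    obtain ⟨h1, h2⟩ := ih (Function.update S (t i) (v i)) fun x hx => by
      rw [Function.update_of_ne (hx i), hS x hx]
    rw [hstep]
    refine ⟨fun j hj => ?_, fun x hx => ?_⟩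
    · by_cases hjl : j ∈ l
      · exact h1 j hjl
      · obtain rfl : j = i := by simpa [hjl] using hj
        rw [h2 _ fun k hk => ht.ne (by rintro rfl; exact hjl hk), Function.update_self]
    · rw [h2 x fun j hj => hx j (by simp [hj]), Function.update_of_ne (hx i (by simp))]

end Prog

/-! ### The reduction -/

namespace Prog

theorem notMem_writes_embed {ρ : ℕ → ℕ} {f : ℕ → ℕ → Prog} {x : ℕ} (hρ : ∀ k, ρ k ≠ x)
    (hf : ∀ d a, x ∉ (f d a).writes) (P : Prog) : x ∉ (P.embed ρ f).writes := by
  induction P with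
  | skip => simp [embed, writes]
  | call d a => exact hf d a
  | seq P Q ihP ihQ => simp [embed, writes, ihP, ihQ]
  | cond a P Q ihP ihQ => simp [embed, writes, ihP, ihQ]
  | loop a P ih => simpa [embed, writes] using ih
  | _ => simp [embed, writes, (hρ _).symm]

/-- `d := a * b mod q` with the modulus `q` in register `1` -/
def mulMod (d a b : ℕ) : Prog := (arith .mul d a b).seq (arith .mod d d 1)

theorem step_mulMod {d : ℕ} (hd : d ≠ 1) (a b : ℕ) (S : Store) :
    (mulMod d a b).step S = Function.update S d (S a * S b % S 1) := by
  simp [mulMod, step, ArithOp.apply, Function.update_of_ne hd.symm]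

theorem straight_mulMod (d a b : ℕ) : (mulMod d a b).Straight := ⟨trivial, trivial⟩

@[simp] theorem writes_mulMod (d a b : ℕ) : (mulMod d a b).writes = {d} := by simp [mulMod, writes]

end Prog

namespace Reduction

open Prog

/-- The registers `0, …, 9` are used by the reduction itself, and the registers `slot c k` for
`c = 0, 1, 2` by the distributor, the adversary, and the receiver. -/
def slot (c k : ℕ) : ℕ := 10 + 3 * k + c

theorem slot_strictMono (c : ℕ) : StrictMono (slot c) := fun a b h => by
  unfold slot; omega

/-- Copy the public parameters. -/
def copyParams (c o : ℕ) : Prog := seqs ((List.finRange 4).map fun k : Fin 4 => copy (slot c (o + k)) k)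

variable (n N : ℕ) (i : Fin n)

/-- Write the public keys into the view; that of voter `i` is in register `4`. -/
def keys : Prog := seqs ((List.finRange n).map fun j =>
  if j = i then copy (slot 1 (4 + j)) 4 else powMod (slot 1 (4 + j)) 2 (slot 1 (4 + n + j)) 1)

/-- Copy the information of the distributor into the view. -/
def info : Prog := seqs ((List.finRange (N + 1)).map fun k : Fin (N + 1) =>
  copy (slot 1 (4 + 2 * n + k)) (slot 0 k))

/-- Multiply register `7` by the powers of register `5` with the given exponents. -/
def powers (l : List (Fin n)) : Prog := seqs (l.map fun j =>
  (powMod 8 5 (slot 1 (4 + n + j)) 1).seq (mulMod 7 7 8))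

/-- Compute the ballot from register `6`, which plays the part of `g ^ (d i * x)`. -/
def ballot (r : ℕ) : Prog :=
  seqs [mulMod 7 6 (slot 0 r), powMod 8 2 (slot 1 (4 + 2 * n + N + 1)) 1, mulMod 7 7 8,
    powers n (List.finRange n), copy (slot 1 (4 + 2 * n + N + 3)) 7]

/-- Compute the view of the adversary. -/
def view (r : ℕ) : Prog :=
  seqs [copyParams 1 0, const (slot 1 (4 + n + i)) 0, keys n i, info n N,
    copy (slot 1 (4 + 2 * n + N + 2)) 5, ballot n N r, copyParams 2 2]

variable {n N i}

theorem straight_copyParams (c o : ℕ) : (copyParams c o).Straight :=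
  straight_seqs (by simp [straight_copy])

theorem straight_keys : (keys n i).Straight :=
  straight_seqs (by
    simp only [List.mem_map, List.mem_finRange, true_and, forall_exists_index,
      forall_apply_eq_imp_iff]
    intro j
    split_ifs
    · exact straight_copy _ _
    · trivial)

theorem straight_info : (info n N).Straight :=
  straight_seqs (by simp [straight_copy])

theorem straight_powers (l : List (Fin n)) : (powers n l).Straight :=
  straight_seqs (by
    simp only [List.mem_map, forall_exists_index, and_imp, forall_apply_eq_imp_iff₂]
    exact fun _ _ => ⟨trivial, straight_mulMod _ _ _⟩)

theorem straight_ballot (r : ℕ) : (ballot n N r).Straight :=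
  ⟨straight_mulMod _ _ _, trivial, straight_mulMod _ _ _, straight_powers _, straight_copy _ _,
    trivial⟩

theorem straight_view (r : ℕ) : (view n N i r).Straight :=
  ⟨straight_copyParams _ _, trivial, straight_keys, straight_info, straight_copy _ _,
    straight_ballot _, straight_copyParams _ _, trivial⟩

theorem mem_writes_copyParams {c o x : ℕ} (h : x ∈ (copyParams c o).writes) :
    ∃ k < 4, x = slot c (o + k) := by
  obtain ⟨P, hP, hx⟩ := mem_writes_seqs.1 h
  obtain ⟨k, -, rfl⟩ := List.mem_map.1 hP
  exact ⟨k, k.2, by simpa using hx⟩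

theorem mem_writes_keys {x : ℕ} (h : x ∈ (keys n i).writes) : ∃ j < n, x = slot 1 (4 + j) := by
  obtain ⟨P, hP, hx⟩ := mem_writes_seqs.1 h
  obtain ⟨k, -, rfl⟩ := List.mem_map.1 hP
  refine ⟨k, k.2, ?_⟩
  split_ifs at hx <;> simpa [writes] using hx

theorem mem_writes_info {x : ℕ} (h : x ∈ (info n N).writes) :
    ∃ k < N + 1, x = slot 1 (4 + 2 * n + k) := by
  obtain ⟨P, hP, hx⟩ := mem_writes_seqs.1 h
  obtain ⟨k, -, rfl⟩ := List.mem_map.1 hP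
  exact ⟨k, k.2, by simpa using hx⟩

theorem mem_writes_powers {l : List (Fin n)} {x : ℕ} (h : x ∈ (powers n l).writes) :
    x = 7 ∨ x = 8 := by
  obtain ⟨P, hP, hx⟩ := mem_writes_seqs.1 h
  obtain ⟨k, -, rfl⟩ := List.mem_map.1 hP
  simp only [writes, writes_mulMod, Finset.mem_union, Finset.mem_singleton] at hx
  exact hx.symm

theorem mem_writes_ballot {r x : ℕ} (h : x ∈ (ballot n N r).writes) :
    x = 7 ∨ x = 8 ∨ x = slot 1 (4 + 2 * n + N + 3) := by
  simp only [ballot, seqs, List.foldr, writes, writes_mulMod, writes_copy, Finset.mem_union,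
    Finset.mem_singleton] at h
  rcases h with h | h | h | h | h | h
  · exact .inl h
  · exact .inr (.inl h)
  · exact .inl h
  · exact (mem_writes_powers h).imp_right .inl
  · exact .inr (.inr h)
  · simp at h

theorem mem_writes_view {r x : ℕ} (h : x ∈ (view n N i r).writes) :
    x = 7 ∨ x = 8 ∨ 10 ≤ x := by
  simp only [view, seqs, List.foldr, writes, writes_copy, Finset.mem_union,
    Finset.mem_singleton] at h
  have aux : ∀ c k, x = slot c k → x = 7 ∨ x = 8 ∨ 10 ≤ x := by
    intro c k; unfold slot; omega
  rcases h with h | h | h | h | h | h | h | h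
  · obtain ⟨k, -, h⟩ := mem_writes_copyParams h; exact aux _ _ h
  · exact aux _ _ h
  · obtain ⟨k, -, h⟩ := mem_writes_keys h; exact aux _ _ h
  · obtain ⟨k, -, h⟩ := mem_writes_info h; exact aux _ _ h
  · exact aux _ _ h
  · rcases mem_writes_ballot h with h | h | h
    · exact .inl h
    · exact .inr (.inl h)
    · exact aux _ _ h
  · obtain ⟨k, -, h⟩ := mem_writes_copyParams h; exact aux _ _ h
  · simp at h

theorem step_copyParams (c o : ℕ) (S : Store) (k : Fin 4) :
    (copyParams c o).step S (slot c (o + k)) = S k := by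
  refine (step_seqs_map (f := fun k : Fin 4 => copy (slot c (o + k)) k)
    (t := fun k => slot c (o + k)) (v := fun k => S k) (S₀ := S) ?_ ?_ _ S fun _ _ => rfl).1 k
    (List.mem_finRange k)
  · intro a b h
    have := (slot_strictMono c).injective h
    omega
  · intro j S' hS'
    rw [step_copy (by unfold slot; omega), hS' _ fun j => by unfold slot; omega]

theorem step_info (S : Store) (k : Fin (N + 1)) :
    (info n N).step S (slot 1 (4 + 2 * n + k)) = S (slot 0 k) := by
  refine (step_seqs_map (f := fun k : Fin (N + 1) => copy (slot 1 (4 + 2 * n + k)) (slot 0 k))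
    (t := fun k => slot 1 (4 + 2 * n + k)) (v := fun k => S (slot 0 k)) (S₀ := S) ?_ ?_ _ S
    fun _ _ => rfl).1 k (List.mem_finRange k)
  · intro a b h
    have := (slot_strictMono 1).injective h
    omega
  · intro j S' hS'
    rw [step_copy (by unfold slot; omega), hS' _ fun j => by unfold slot; omega]

theorem step_keys (S : Store) (j : Fin n) : (keys n i).step S (slot 1 (4 + j)) =
    if j = i then S 4 else powModVal (S 2) (S (slot 1 (4 + n + j))) (S 1) := by
  refine (step_seqs_map (f := fun j : Fin n =>
      if j = i then copy (slot 1 (4 + j)) 4 else powMod (slot 1 (4 + j)) 2 (slot 1 (4 + n + j)) 1)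
    (t := fun k => slot 1 (4 + k))
    (v := fun j => if j = i then S 4 else powModVal (S 2) (S (slot 1 (4 + n + j))) (S 1))
    (S₀ := S) ?_ ?_ _ S fun _ _ => rfl).1 j (List.mem_finRange j)
  · intro a b h
    have := (slot_strictMono 1).injective h
    omega
  · intro j S' hS'
    have h : ∀ x, x < 10 → S' x = S x := fun x hx => hS' _ fun j => by unfold slot; omega
    split_ifs
    · rw [step_copy (by unfold slot; omega), h _ (by norm_num)]
    · rw [step, h 2 (by norm_num), h 1 (by norm_num),
        hS' (slot 1 (4 + n + j)) fun j => by unfold slot; omega]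

theorem powModVal_val {q : ℕ} [NeZero q] (x : ZMod q) (e : ℕ) :
    powModVal x.val e q = (x ^ e).val := by
  rw [powModVal, if_neg (NeZero.ne q), ← ZMod.val_natCast]
  simp

/-- Register `7` accumulates the product, starting from an arbitrary `z` so that the induction goes
through; register `8` is scratch space. -/
theorem step_powers {q : ℕ} [NeZero q] (h : ZMod q) (l : List (Fin n)) (d : Fin n → ℕ) :
    ∀ (S : Store) (z : ZMod q), S 1 = q → S 5 = h.val → (∀ j : Fin n, S (slot 1 (4 + n + j)) = d j) →
      S 7 = z.val → (powers n l).step S 7 = (z * (l.map fun j => h ^ d j).prod).val := by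
  induction l with
  | nil => intro S z _ _ _ hz; simpa [powers, seqs, step] using hz
  | cons j l ih =>
    intro S z h1 h5 hd h7
    have h8 : ∀ j : Fin n, slot 1 (4 + n + j) ≠ 8 := fun j => by unfold slot; omega
    have h7' : ∀ j : Fin n, slot 1 (4 + n + j) ≠ 7 := fun j => by unfold slot; omega
    have : (powers n (j :: l)).step S =
        (powers n l).step ((mulMod 7 7 8).step ((powMod 8 5 (slot 1 (4 + n + j)) 1).step S)) := rfl
    rw [this, step_mulMod (by norm_num), step, h1, h5, hd, powModVal_val,
      ih _ (z * h ^ d j)]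
    · simp [mul_assoc]
    · simp [h1]
    · simp [h5]
    · intro j; simp [h8, h7', hd]
    · simp [h1, h7, ZMod.val_mul]

theorem step_ballot {q : ℕ} [NeZero q] {g h z : ZMod q} {S : Store} {d : Fin n → ℕ} {r : ℕ}
    (h1 : S 1 = q) (h2 : S 2 = g.val) (h5 : S 5 = h.val) (h6 : S 6 = z.val)
    (hd : ∀ j : Fin n, S (slot 1 (4 + n + j)) = d j) :
    (ballot n N r).step S (slot 1 (4 + 2 * n + N + 3)) =
      (z * (S (slot 0 r) : ZMod q) * g ^ S (slot 1 (4 + 2 * n + N + 1)) *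
        ∏ j, h ^ d j).val := by
  have e : ∀ c k x, x < 10 → slot c k ≠ x := fun c k x hx => by unfold slot; omega
  have : (ballot n N r).step S =
    (copy (slot 1 (4 + 2 * n + N + 3)) 7).step ((powers n (List.finRange n)).step
      ((mulMod 7 7 8).step ((powMod 8 2 (slot 1 (4 + 2 * n + N + 1)) 1).step
        ((mulMod 7 6 (slot 0 r)).step S)))) := rfl
  rw [this, step_copy (e _ _ _ (by norm_num)), Function.update_self,
    step_powers h (List.finRange n) d _
      (z * (S (slot 0 r) : ZMod q) * g ^ S (slot 1 (4 + 2 * n + N + 1)))]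
  · rw [← List.ofFn_eq_map, List.prod_ofFn]
  · simp [step_mulMod, step, h1]
  · simp [step_mulMod, step, h5]
  · intro j
    simp [step_mulMod, step, e, hd]
  · have hz : z.val * S (slot 0 r) % q = (z * (S (slot 0 r) : ZMod q)).val := by
      rw [← ZMod.val_natCast]; simp
    simp [step_mulMod, step, h1, h2, h6, e, hz, powModVal_val, ← ZMod.val_mul]

end Reduction

/-! ### Correctness of the prepared view -/

theorem Store.ofList_append (l₁ l₂ : List ℕ) (k : ℕ) : Store.ofList (l₁ ++ l₂) k =
    if k < l₁.length then Store.ofList l₁ k else Store.ofList l₂ (k - l₁.length) := by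
  unfold Store.ofList
  split_ifs with h
  · exact List.getD_append _ _ _ _ h
  · exact List.getD_append_right _ _ _ _ (by omega)

theorem Store.ofList_ofFn_apply {n k : ℕ} (f : Fin n → ℕ) (hk : k < n) :
    Store.ofList (List.ofFn f) k = f ⟨k, hk⟩ := by
  unfold Store.ofList
  rw [List.getD_eq_getElem _ _ (by simpa using hk)]
  simp

namespace Reduction

open Prog

variable {F : GroupFamily} {κ n N : ℕ} {i : Fin n}

/-- The registers hold the public parameters. -/
def HasParams (F : GroupFamily) (κ : ℕ) (S : Store) : Prop :=
  ∀ k < 4, S k = Store.ofList (F.params κ) k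

/-- The offsets reflect the blocks of the list: four parameters, `n` public keys, `n` private keys,
`N + 1` registers of the distributor, and three final entries. -/
theorem apply_view {d : Fin n → F.Exponent κ} {st : Store} {s x : F.Exponent κ}
    {b : ZMod (F.q κ)} {S : Store} (h₁ : ∀ k < 4, S k = Store.ofList (F.params κ) k)
    (h₂ : ∀ j : Fin n, S (4 + j) = F.power κ (d j))
    (h₃ : ∀ j : Fin n, S (4 + n + j) = if j = i then 0 else (d j : ℕ))
    (h₄ : ∀ k : Fin (N + 1), S (4 + 2 * n + k) = st k) (h₅ : S (4 + 2 * n + N + 1) = s)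
    (h₆ : S (4 + 2 * n + N + 2) = F.power κ x) (h₇ : S (4 + 2 * n + N + 3) = b.val)
    (h₈ : ∀ k, 4 + 2 * n + N + 4 ≤ k → S k = 0) (k : ℕ) :
    S k = Store.ofList (Election.view F i κ d st s x b N) k := by
  have hp : (F.params κ).length = 4 := rfl
  simp only [Election.view, Store.ofList_append, List.length_append, List.length_ofFn, hp]
  split_ifs with c1 c2 c3 c4
  · exact h₁ k c4
  · obtain ⟨j, rfl⟩ := Nat.exists_eq_add_of_le (not_lt.1 c4)
    rw [Nat.add_sub_cancel_left]
    have hj : j < n := by omega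
    rw [Store.ofList_ofFn_apply _ hj]
    exact h₂ ⟨j, hj⟩
  · obtain ⟨j, rfl⟩ := Nat.exists_eq_add_of_le (not_lt.1 c3)
    rw [Nat.add_sub_cancel_left]
    have hj : j < n := by omega
    rw [Store.ofList_ofFn_apply _ hj]
    exact h₃ ⟨j, hj⟩
  · obtain ⟨j, rfl⟩ := Nat.exists_eq_add_of_le (not_lt.1 c2)
    rw [Nat.add_sub_cancel_left, show 4 + n + n = 4 + 2 * n by omega]
    have hj : j < N + 1 := by omega
    rw [Store.ofList_ofFn_apply _ hj]
    exact h₄ ⟨j, hj⟩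
  · obtain ⟨j, rfl⟩ := Nat.exists_eq_add_of_le (not_lt.1 c1)
    rw [Nat.add_sub_cancel_left, show 4 + n + n + (N + 1) + j = 4 + 2 * n + N + 1 + j by omega]
    match j with
    | 0 => exact h₅
    | 1 => exact h₆
    | 2 => exact h₇
    | j + 3 => rw [h₈ _ (by omega)]; simp [Store.ofList]

/-- The value in the ballot register when register `6` represents `z`. -/
def ballotValue (F : GroupFamily) (i : Fin n) (κ p s x : ℕ) (d : Fin n → F.Exponent κ)
    (z : ZMod (F.q κ)) : ZMod (F.q κ) :=
  z * (p : ZMod (F.q κ)) * (F.g κ : ZMod (F.q κ)) ^ s *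
    ∏ j, ((F.g κ : ZMod (F.q κ)) ^ x) ^ (if j = i then 0 else (d j : ℕ))

theorem power_eq (F : GroupFamily) (κ a : ℕ) :
    F.power κ a = ((F.g κ : ZMod (F.q κ)) ^ a).val := by
  simp [GroupFamily.power]

/-- The entry for the private key of voter `i` is set to `0` before the ballot is computed. This is
what the view prescribes, and it also drops the factor of voter `i` from the product of powers,
which register `6` replaces. -/
theorem step_view {d : Fin n → F.Exponent κ} {st : Store} {s x : F.Exponent κ}
    {z : ZMod (F.q κ)} {r : Fin N} {S : Store} (hS : HasParams F κ S)
    (h4 : S 4 = F.power κ (d i)) (h5 : S 5 = F.power κ x) (h6 : S 6 = z.val)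
    (hd : ∀ j : Fin n, j ≠ i → S (slot 1 (4 + n + j)) = d j) (hst : ∀ k, S (slot 0 k) = st k)
    (hs : S (slot 1 (4 + 2 * n + N + 1)) = s)
    (h0 : ∀ k, 4 + 2 * n + N + 4 ≤ k → S (slot 1 k) = 0) (h2 : ∀ k, S (slot 2 k) = 0) :
    (∀ k < 4, (view n N i r).step S k = S k) ∧
    (∀ k, (view n N i r).step S (slot 1 k) = Store.ofList
      (Election.view F i κ d st s x (ballotValue F i κ (st r) s x d z) N) k) ∧
    ∀ k, 2 ≤ k →
      (view n N i r).step S (slot 2 k) = OTProtocol.receiverInit (F.params κ) r k := by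
  set S₁ := (copyParams 1 0).step S with hS₁
  set S₂ := (const (slot 1 (4 + n + i)) 0).step S₁ with hS₂
  set S₃ := (keys n i).step S₂ with hS₃
  set S₄ := (info n N).step S₃ with hS₄
  set S₅ := (copy (slot 1 (4 + 2 * n + N + 2)) 5).step S₄ with hS₅
  set S₆ := (ballot n N r).step S₅ with hS₆
  set S₇ := (copyParams 2 2).step S₆ with hS₇
  have hview : (view n N i r).step S = S₇ := rfl
  rw [hview]
  -- The facts `f₁` to `f₇` are frame conditions, one for each stage; every later value is obtained
  -- by tracing its register back to the stage that wrote it.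
  have f₁ : ∀ x, (∀ k < 4, x ≠ slot 1 (0 + k)) → S₁ x = S x := fun x hx =>
    step_of_notMem_writes _ (fun h => by
      obtain ⟨k, hk, h⟩ := mem_writes_copyParams h; exact hx k hk h) S
  have f₂ : ∀ x, x ≠ slot 1 (4 + n + i) → S₂ x = S₁ x := fun x hx =>
    Function.update_of_ne hx _ _
  have f₃ : ∀ x, (∀ k < n, x ≠ slot 1 (4 + k)) → S₃ x = S₂ x := fun x hx =>
    step_of_notMem_writes _ (fun h => by
      obtain ⟨k, hk, h⟩ := mem_writes_keys h; exact hx k hk h) S₂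
  have f₄ : ∀ x, (∀ k < N + 1, x ≠ slot 1 (4 + 2 * n + k)) → S₄ x = S₃ x := fun x hx =>
    step_of_notMem_writes _ (fun h => by
      obtain ⟨k, hk, h⟩ := mem_writes_info h; exact hx k hk h) S₃
  have f₅ : ∀ x, x ≠ slot 1 (4 + 2 * n + N + 2) → S₅ x = S₄ x := fun x hx =>
    step_of_notMem_writes _ (by simpa using hx) S₄
  have f₆ : ∀ x, x ≠ 7 → x ≠ 8 → x ≠ slot 1 (4 + 2 * n + N + 3) → S₆ x = S₅ x :=
    fun x h1 h2 h3 => step_of_notMem_writes _ (fun h => by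
      rcases mem_writes_ballot h with h | h | h <;> contradiction) S₅
  have f₇ : ∀ x, (∀ k < 4, x ≠ slot 2 (2 + k)) → S₇ x = S₆ x := fun x hx =>
    step_of_notMem_writes _ (fun h => by
      obtain ⟨k, hk, h⟩ := mem_writes_copyParams h; exact hx k hk h) S₆
  have low₅ : ∀ x < 10, S₅ x = S x := fun x hx => by
    rw [f₅ _ (by unfold slot; omega), f₄ _ (by unfold slot; omega), f₃ _ (by unfold slot; omega),
      f₂ _ (by unfold slot; omega), f₁ _ (by unfold slot; omega)]
  have low₆ : ∀ x < 4, S₆ x = S x := fun x hx => by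
    rw [f₆ _ (by omega) (by omega) (by unfold slot; omega), low₅ _ (by omega)]
  have hdS₂ : ∀ j : Fin n, S₂ (slot 1 (4 + n + j)) = if j = i then 0 else (d j : ℕ) := fun j => by
    split_ifs with hj
    · rw [hj, hS₂, step, Function.update_self]
    · have : (j : ℕ) ≠ i := fun h => hj (Fin.ext h)
      rw [f₂ _ (by unfold slot; omega), f₁ _ (by unfold slot; omega), hd j hj]
  have hdS₅ : ∀ j : Fin n, S₅ (slot 1 (4 + n + j)) = if j = i then 0 else (d j : ℕ) := fun j => by
    rw [f₅ _ (by unfold slot; omega), f₄ _ (by unfold slot; omega), f₃ _ (by unfold slot; omega),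
      hdS₂]
  have hq : S 1 = F.q κ := hS 1 (by norm_num)
  have hg : S 2 = (F.g κ : ZMod (F.q κ)).val := hS 2 (by norm_num)
  have hstS₅ : ∀ k, S₅ (slot 0 k) = st k := fun k => by
    rw [f₅ _ (by unfold slot; omega), f₄ _ (by unfold slot; omega), f₃ _ (by unfold slot; omega),
      f₂ _ (by unfold slot; omega), f₁ _ (by unfold slot; omega), hst]
  have hsS₅ : S₅ (slot 1 (4 + 2 * n + N + 1)) = s := by
    rw [f₅ _ (by unfold slot; omega), f₄ _ (by unfold slot; omega), f₃ _ (by unfold slot; omega),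
      f₂ _ (by unfold slot; omega), f₁ _ (by unfold slot; omega), hs]
  refine ⟨fun k hk => by rw [f₇ _ (by unfold slot; omega), low₆ k hk], ?_, ?_⟩
  · refine apply_view (S := fun k => S₇ (slot 1 k)) (fun k hk => ?_) (fun j => ?_) (fun j => ?_)
      (fun k => ?_) ?_ ?_ ?_ fun k hk => ?_
    · rw [f₇ _ (by unfold slot; omega), f₆ _ (by unfold slot; omega) (by unfold slot; omega)
        (by unfold slot; omega), f₅ _ (by unfold slot; omega), f₄ _ (by unfold slot; omega),
        f₃ _ (by unfold slot; omega), f₂ _ (by unfold slot; omega)]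
      have := step_copyParams 1 0 S ⟨k, hk⟩
      rw [zero_add] at this
      rw [hS₁, ← hS k hk]
      exact this
    · rw [f₇ _ (by unfold slot; omega), f₆ _ (by unfold slot; omega) (by unfold slot; omega)
        (by unfold slot; omega), f₅ _ (by unfold slot; omega), f₄ _ (by unfold slot; omega), hS₃,
        step_keys, hdS₂]
      have low₂ : ∀ x < 10, S₂ x = S x := fun x hx => by
        rw [f₂ _ (by unfold slot; omega), f₁ _ (by unfold slot; omega)]
      rw [low₂ _ (by norm_num), low₂ _ (by norm_num), low₂ _ (by norm_num), h4, hq, hg,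
        powModVal_val]
      split_ifs with hj
      · rw [hj]
      · rw [power_eq]
    · rw [f₇ _ (by unfold slot; omega), f₆ _ (by unfold slot; omega) (by unfold slot; omega)
        (by unfold slot; omega), hdS₅]
    · rw [f₇ _ (by unfold slot; omega), f₆ _ (by unfold slot; omega) (by unfold slot; omega)
        (by unfold slot; omega), f₅ _ (by unfold slot; omega), hS₄, step_info,
        f₃ _ (by unfold slot; omega), f₂ _ (by unfold slot; omega), f₁ _ (by unfold slot; omega),
        hst]
    · rw [f₇ _ (by unfold slot; omega), f₆ _ (by unfold slot; omega) (by unfold slot; omega)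
        (by unfold slot; omega), hsS₅]
    · rw [f₇ _ (by unfold slot; omega), f₆ _ (by unfold slot; omega) (by unfold slot; omega)
        (by unfold slot; omega), hS₅, step_copy (by unfold slot; omega), Function.update_self,
        ← h5, ← low₅ 5 (by norm_num), f₅ _ (by unfold slot; omega)]
    · rw [f₇ _ (by unfold slot; omega), hS₆, step_ballot (z := z)
        (g := (F.g κ : ZMod (F.q κ))) (h := (F.g κ : ZMod (F.q κ)) ^ (x : ℕ))
        ((low₅ 1 (by norm_num)).trans hq) ((low₅ 2 (by norm_num)).trans hg)
        ((low₅ 5 (by norm_num)).trans (h5.trans (power_eq _ _ _)))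
        ((low₅ 6 (by norm_num)).trans h6) hdS₅, hstS₅, hsS₅]
      rfl
    · rw [f₇ _ (by unfold slot; omega), f₆ _ (by unfold slot; omega) (by unfold slot; omega)
        (by unfold slot; omega), f₅ _ (by unfold slot; omega), f₄ _ (by unfold slot; omega),
        f₃ _ (by unfold slot; omega), f₂ _ (by unfold slot; omega), f₁ _ (by unfold slot; omega),
        h0 k hk]
  · intro k hk
    obtain ⟨k, rfl⟩ := Nat.exists_eq_add_of_le hk
    have : OTProtocol.receiverInit (F.params κ) r (2 + k) = Store.ofList (F.params κ) k := by
      simp [OTProtocol.receiverInit, Store.ofList, add_comm 2 k]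
    rw [this]
    by_cases hk4 : k < 4
    · rw [hS₇, step_copyParams 2 2 S₆ ⟨k, hk4⟩, low₆ _ hk4, hS k hk4]
    · rw [f₇ _ (by unfold slot; omega), f₆ _ (by unfold slot; omega) (by unfold slot; omega)
        (by unfold slot; omega), f₅ _ (by unfold slot; omega), f₄ _ (by unfold slot; omega),
        f₃ _ (by unfold slot; omega), f₂ _ (by unfold slot; omega), f₁ _ (by unfold slot; omega),
        h2]
      exact (List.getD_eq_default _ _ (by simpa [GroupFamily.params] using hk4)).symm

end Reduction

/-! ### Uniform distributions -/

theorem PMF.map_uniformOfFintype_equiv {α β : Type} [Fintype α] [Nonempty α] [Fintype β]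
    [Nonempty β] (e : α ≃ β) : (PMF.uniformOfFintype α).map e = PMF.uniformOfFintype β := by
  ext b
  rw [PMF.map_apply, tsum_eq_single (e.symm b)]
  · simp [Fintype.card_congr e]
  · intro a ha
    rw [if_neg]
    rintro rfl
    simp at ha

theorem PMF.bind_uniformOfFintype_prod {α β γ : Type} [Fintype α] [Nonempty α] [Fintype β]
    [Nonempty β] (f : α × β → PMF γ) :
    (PMF.uniformOfFintype (α × β)).bind f =
      (PMF.uniformOfFintype α).bind fun a => (PMF.uniformOfFintype β).bind fun b => f (a, b) := by
  have : PMF.uniformOfFintype (α × β) =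
      (PMF.uniformOfFintype α).bind fun a => (PMF.uniformOfFintype β).map fun b => (a, b) := by
    ext ⟨a, b⟩
    rw [PMF.bind_apply, tsum_eq_single a, PMF.map_apply, tsum_eq_single b]
    · simp only [uniformOfFintype_apply, Fintype.card_prod, Nat.cast_mul, if_true]
      rw [ENNReal.mul_inv (by simp) (by simp)]
    · intro b' hb'
      rw [if_neg (by simpa using hb'.symm)]
    · intro a' ha'
      rw [mul_eq_zero]
      right
      rw [PMF.map_apply]
      simp [ha'.symm]
  rw [this, PMF.bind_bind]
  simp only [PMF.bind_map]
  rfl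

/-- Resampling one coordinate of a uniformly random function does not change its distribution. -/
theorem PMF.bind_uniformOfFintype_update {ι α γ : Type} [Fintype ι] [DecidableEq ι] [Fintype α]
    [Nonempty α] (i : ι) (f : (ι → α) → PMF γ) :
    ((PMF.uniformOfFintype α).bind fun a => (PMF.uniformOfFintype (ι → α)).bind fun d =>
      f (Function.update d i a)) = (PMF.uniformOfFintype (ι → α)).bind f := by
  -- A uniform function is a uniform value at `i` together with an independent uniform restriction
  -- to the other indices; the overwritten value at `i` then integrates out.
  have key : ∀ g : (ι → α) → PMF γ, (PMF.uniformOfFintype (ι → α)).bind g =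
      (PMF.uniformOfFintype α).bind fun a => (PMF.uniformOfFintype ({j // j ≠ i} → α)).bind
        fun d => g ((Equiv.funSplitAt i α).symm (a, d)) := by
    intro g
    rw [← PMF.map_uniformOfFintype_equiv (Equiv.funSplitAt i α).symm, PMF.bind_map,
      PMF.bind_uniformOfFintype_prod]
    rfl
  rw [key f]
  refine congrArg _ (funext fun a => ?_)
  rw [key]
  have : ∀ a' (d : {j // j ≠ i} → α), Function.update ((Equiv.funSplitAt i α).symm (a', d)) i a =
      (Equiv.funSplitAt i α).symm (a, d) := by
    intro a' d
    ext j
    by_cases hj : j = i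
    · subst hj; simp [Equiv.funSplitAt, Equiv.piSplitAt]
    · simp [Equiv.funSplitAt, Equiv.piSplitAt, hj]
  simp only [this, PMF.bind_const]

/-! ### Distributions of composed runs -/

namespace Prog

variable {σ : Type} {O : Peer σ} {P Q : Prog} {S : Store} {s : σ}

/-- Halting of the whole program, known from the efficiency bounds, passes to both parts. Only
distributions remain to be followed. -/
theorem Halts.coupled_seq {α β : Type} {μ : PMF α} {f : α → PMF β} {R : α → Store → σ → Prop}
    {R' : β → Store → σ → Prop} (h : (P.seq Q).Halts O S s)
    (hP : P.Halts O S s → PMF.Coupled (fun a out => R a out.1 out.2) μ (P.result O S s))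
    (hQ : ∀ a S' t, R a S' t → Q.Halts O S' t →
      PMF.Coupled (fun b out => R' b out.1 out.2) (f a) (Q.result O S' t)) :
    PMF.Coupled (fun b out => R' b out.1 out.2) (μ.bind f) ((P.seq Q).result O S s) := by
  obtain ⟨T, hT⟩ := h
  obtain ⟨h1, h2, h3⟩ := hT.of_seq
  rw [h3]
  refine ((hP ⟨T, h1⟩).mono_support (R' := fun a out => R a out.1 out.2 ∧
    Q.Halts O out.1 out.2) fun a _ out hout hR => ⟨hR, T, h2 out hout⟩).bind ?_
  exact fun a out hR => hQ a out.1 out.2 hR.1 hR.2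

theorem Halts.coupled_seq_straight {β : Type} {μ : PMF β} {R : β → Store → σ → Prop}
    (h : (P.seq Q).Halts O S s) (hP : P.Straight)
    (hQ : Q.Halts O (P.step S) s →
      PMF.Coupled (fun b out => R b out.1 out.2) μ (Q.result O (P.step S) s)) :
    PMF.Coupled (fun b out => R b out.1 out.2) μ ((P.seq Q).result O S s) := by
  rw [← PMF.pure_bind () fun _ => μ]
  refine h.coupled_seq (R := fun _ S' t => S' = P.step S ∧ t = s) (fun _ => ?_) ?_
  · rw [(hP.runs O S s).2]
    exact .pure ⟨rfl, rfl⟩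
  · rintro - _ _ ⟨rfl, rfl⟩
    exact hQ

end Prog

namespace Reduction

open Prog

variable {σ : Type} {O : Peer σ} {F : GroupFamily} {κ n N : ℕ} {i : Fin n} {P setup U : Prog}
  {S : Store} {s : σ}

theorem coupled_rand (O : Peer σ) (s : σ) (hS : S 3 = orderOf (F.g κ)) (x : ℕ) :
    PMF.Coupled (fun (a : F.Exponent κ) out => out.1 = Function.update S x a ∧ out.2 = s)
      (PMF.uniformOfFintype (F.Exponent κ)) ((rand x 3).result O S s) := by
  rw [(runs_rand O S s x 3).2, hS, uniformBelow_eq, PMF.map_comp]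
  conv => arg 2; rw [← PMF.map_id (PMF.uniformOfFintype _)]
  exact PMF.Coupled.map (R := (· = ·)) (.refl fun _ _ => rfl) (by rintro a _ rfl; exact ⟨rfl, rfl⟩)

theorem coupled_rands (O : Peer σ) (s : σ) (t : Fin n → ℕ) (ht : Function.Injective t)
    (ht3 : ∀ j, t j ≠ 3) (l : List (Fin n)) (hl : l.Nodup) :
    ∀ S : Store, S 3 = orderOf (F.g κ) → (seqs (l.map fun j => rand (t j) 3)).Halts O S s →
    PMF.Coupled (fun (d : Fin n → F.Exponent κ) out => (∀ j ∈ l, out.1 (t j) = (d j : ℕ)) ∧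
        (∀ x, (∀ j ∈ l, x ≠ t j) → out.1 x = S x) ∧ out.2 = s)
      (PMF.uniformOfFintype (Fin n → F.Exponent κ))
      ((seqs (l.map fun j => rand (t j) 3)).result O S s) := by
  induction l with
  | nil =>
    intro S _ _
    rw [show seqs (([] : List (Fin n)).map fun j => rand (t j) 3) = skip from rfl,
      (runs_skip O S s).2]
    refine (PMF.Coupled.of_left (R := fun _ _ => True) fun _ _ _ => trivial).mono_support ?_
    intro d _ out hout _
    obtain rfl : out = (S, s) := by simpa using hout
    simp
  | cons j l ih =>
    intro S hS hH
    rw [List.nodup_cons] at hl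
    -- The uniform function on the left is rewritten as one whose coordinate `j` is drawn
    -- separately, matching the first `rand`; the induction hypothesis handles the others.
    have := PMF.bind_uniformOfFintype_update (α := F.Exponent κ) j
      (f := fun d : Fin n → F.Exponent κ => PMF.pure d)
    rw [PMF.bind_pure] at this
    rw [← this]
    refine hH.coupled_seq (R := fun (a : F.Exponent κ) S' t' => S' = Function.update S (t j) a ∧ t' = s)
      (R' := fun (d : Fin n → F.Exponent κ) S' t' => (∀ k ∈ j :: l, S' (t k) = (d k : ℕ)) ∧
        (∀ x, (∀ k ∈ j :: l, x ≠ t k) → S' x = S x) ∧ t' = s)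
      (fun _ => coupled_rand O s hS (t j)) ?_
    rintro a _ _ ⟨rfl, rfl⟩ hH'
    refine (ih hl.2 _ (by rw [Function.update_of_ne (ht3 j).symm, hS]) hH').map
      (f := fun d => Function.update d j a) (g := id) ?_ |> fun h => by rwa [PMF.map_id] at h
    rintro d out ⟨h1, h2, h3⟩
    refine ⟨fun k hk => ?_, fun x hx => ?_, h3⟩
    · by_cases hkj : k = j
      · subst hkj
        rw [id, h2 _ fun k' hk' => ht.ne (by rintro rfl; exact hl.1 hk'), Function.update_self,
          Function.update_self]
      · rw [Function.update_of_ne hkj]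
        exact h1 k (by simpa [hkj] using hk)
    · rw [id, h2 x fun k hk => hx k (by simp [hk]), Function.update_of_ne (hx j (by simp))]

end Reduction

/-! ### The run of the reduction -/

namespace Reduction

open Prog

variable {σ : Type} {O : Peer σ} {F : GroupFamily} {κ n N : ℕ} {i : Fin n} {P setup U : Prog}
  {S : Store} {s : σ}

/-- Choose the private keys of the voters. -/
def privateKeys (n : ℕ) : Prog :=
  seqs ((List.finRange n).map fun j : Fin n => rand (slot 1 (4 + n + j)) 3)

/-- Run the distributor's program `setup`, prepare the view of the adversary for the public key in
register `4`, the element `g ^ x` in register `5`, and the element in register `6`, and run the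
adversary `U`. -/
def reduction (setup : Prog) (n N : ℕ) (i : Fin n) (r : ℕ) (U : Prog) : Prog :=
  (copyParams 0 0).seq ((embedAt (slot 0) (noCall (slot 0)) setup).seq ((privateKeys n).seq
    ((rand (slot 1 (4 + 2 * n + N + 1)) 3).seq ((view n N i r).seq (U.seq (copy 0 (slot 1 0)))))))

theorem slot_ne {c k x : ℕ} (h : x < 10) : slot c k ≠ x := by unfold slot; omega

theorem mem_writes_privateKeys {x : ℕ} (h : x ∈ (privateKeys n).writes) :
    ∃ j < n, x = slot 1 (4 + n + j) := by
  obtain ⟨P, hP, hx⟩ := mem_writes_seqs.1 h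
  obtain ⟨k, -, rfl⟩ := List.mem_map.1 hP
  exact ⟨k, k.2, by simpa [writes] using hx⟩

theorem efficient_seqs {l : List Prog} (h : ∀ P ∈ l, P.Efficient ∧ 0 ∉ P.writes) :
    (seqs l).Efficient := by
  induction l with
  | nil => exact efficient_skip
  | cons P l ih =>
    exact (h P (by simp)).1.seq (h P (by simp)).2 (ih fun Q hQ => h Q (by simp [hQ]))

theorem efficient_reduction (hsetup : setup.PolyTime) (hU : U.Efficient) (h0 : 0 ∉ U.writes)
    (r : ℕ) : (reduction setup n N i r U).Efficient := by
  have hparams : 0 ∉ (copyParams 0 0).writes := fun h => by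
    obtain ⟨k, -, h⟩ := mem_writes_copyParams h
    exact slot_ne (by norm_num) h.symm
  refine ((straight_copyParams 0 0).efficient hparams).seq hparams
    ((efficient_embedAt_noCall (slot_strictMono 0) (by simp [slot]) hsetup).seq ?_
    (Efficient.seq (efficient_seqs ?_) ?_ ((efficient_rand _ _).seq ?_
    (((straight_view r).efficient ?_).seq ?_ (hU.seq h0 (efficient_copy ?_))))))
  · have := notMem_writes_embed (ρ := slot 0) (f := noCall (slot 0)) (x := 0)
      (fun k => slot_ne (by norm_num))
      (fun d a => by simp [noCall, writes, (slot_ne (c := 0) (k := d) (show 0 < 10 by norm_num)).symm])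
      setup
    simp [embedAt, writes, this, (slot_ne (c := 0) (k := 0) (show 0 < 10 by norm_num)).symm]
  · simp only [List.mem_map, List.mem_finRange, true_and, forall_exists_index,
      forall_apply_eq_imp_iff]
    exact fun j => ⟨efficient_rand _ _, by
      simp [writes, (slot_ne (c := 1) (k := 4 + n + j) (show 0 < 10 by norm_num)).symm]⟩
  · intro h
    obtain ⟨k, -, h⟩ := mem_writes_privateKeys h
    exact slot_ne (by norm_num) h.symm
  · simp [writes, (slot_ne (c := 1) (k := 4 + 2 * n + N + 1) (show 0 < 10 by norm_num)).symm]
  · intro h; have := mem_writes_view h; omega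
  · intro h; have := mem_writes_view h; omega
  · exact (slot_ne (by norm_num)).symm

theorem HasParams.mono {S S' : Store} (h : HasParams F κ S) (hS : ∀ x < 10, S' x = S x) :
    HasParams F κ S' := fun k hk => (hS k (by omega)).trans (h k hk)

theorem coupled_setup (hsetup : setup.PolyTime) (hS : HasParams F κ S)
    (hS0 : ∀ k, S (slot 0 k) = Store.ofList (F.params κ) k) :
    PMF.Coupled (fun st out => (∀ k, out.1 (slot 0 k) = st k) ∧
        (∀ x, (∀ k, x ≠ slot 0 k) → out.1 x = S x) ∧ out.2 = s)
      (setupResult F setup κ) ((embedAt (slot 0) (noCall (slot 0)) setup).result O S s) := by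
  obtain ⟨T, hT⟩ := hsetup
  obtain ⟨L, hL⟩ : ∃ L, ∀ x ∈ [F.q κ, (F.g κ : ZMod (F.q κ)).val, orderOf (F.g κ)], x < 2 ^ L := by
    refine ⟨F.q κ + (F.g κ : ZMod (F.q κ)).val + orderOf (F.g κ), fun x hx => ?_⟩
    refine Nat.lt_two_pow_self.trans_le (Nat.pow_le_pow_right (by norm_num) ?_)
    simp only [List.mem_cons, List.not_mem_nil, or_false] at hx
    omega
  have hT := hT κ L _ Unit noPeer () (fun _ => True) hL trivial (by simp [noPeer])
  have := simulates_embedAt (O := O) (S := S) (s := s) (P := setup) (f := noCall (slot 0))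
    (st := Store.ofList (F.params κ)) (slot_strictMono 0).injective (slot_ne (by norm_num))
    (hS 0 (by norm_num)).symm (fun k _ => hS0 k)
    (R := fun out S' t => (∀ k, S' (slot 0 k) = out.1 k) ∧
      (∀ x, (∀ k, x ≠ slot 0 k) → S' x = S x) ∧ t = s)
    fun S' h1 h2 => (hT.embed_noCall (O' := O) (s' := s) (slot_strictMono 0).injective h1).mono
      le_rfl fun out S'' t h => ⟨h.1, fun x hx => (h.2.1 x hx).trans (h2 x (hx 0)), h.2.2⟩
  have := this.coupled.map (f := Prod.fst) (g := id) (S := fun st out =>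
    (∀ k, out.1 (slot 0 k) = st k) ∧ (∀ x, (∀ k, x ≠ slot 0 k) → out.1 x = S x) ∧ out.2 = s)
    fun _ _ h => h
  rwa [PMF.map_id] at this

/-- The run `U` of the adversary on a prepared view has the same output as `P` together with the
receiver of `ot` in the state `t`. -/
def Emulates (F : GroupFamily) (κ : ℕ) (ot : OTProtocol) (P : Prog) (t : Store) (O : Peer σ) (s : σ)
    (r : ℕ) (U : Prog) : Prop :=
  ∀ (S : Store) (xs : List ℕ), HasParams F κ S →
    (∀ k, S (slot 1 k) = Store.ofList (κ :: xs) k) →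
    (∀ k, 2 ≤ k → S (slot 2 k) = OTProtocol.receiverInit (F.params κ) r k) →
    PMF.Coupled (fun out out' => out'.1 (slot 1 0) = out.1 0)
      (P.result ot.receiverPeer (Store.ofList (κ :: xs)) t) (U.result O S s)

/-- The program draws private keys for all voters, but the one of voter `i` is discarded and its
place is taken by the unknown exponent `a`, of which only `g ^ a` is available. -/
theorem coupled_reduction {ot : OTProtocol} {t : Store} {r : Fin N} {a x : F.Exponent κ}
    {z : ZMod (F.q κ)} (hsetup : setup.PolyTime)
    (hH : (reduction setup n N i r U).Halts O S s) (hU : Emulates F κ ot P t O s r U)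
    (hS : HasParams F κ S) (h4 : S 4 = F.power κ a) (h5 : S 5 = F.power κ x) (h6 : S 6 = z.val)
    (h0 : ∀ k, 10 ≤ k → S k = 0) :
    PMF.Coupled (fun out out' => out'.1 0 = out.1 0)
      ((setupResult F setup κ).bind fun st =>
        (PMF.uniformOfFintype (Fin n → F.Exponent κ)).bind fun d =>
        (PMF.uniformOfFintype (F.Exponent κ)).bind fun m =>
        P.result ot.receiverPeer (Store.ofList (Election.view F i κ (Function.update d i a) st m x
          (ballotValue F i κ (st r) m x d z) N)) t)
      ((reduction setup n N i r U).result O S s) := by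
  have h0' : ∀ c k, S (slot c k) = 0 := fun c k => h0 _ (by unfold slot; omega)
  set S₁ := (copyParams 0 0).step S with hS₁
  have hf₁ : ∀ x, (∀ k < 4, x ≠ slot 0 (0 + k)) → S₁ x = S x := fun x hx =>
    step_of_notMem_writes _ (fun h => by
      obtain ⟨k, hk, h⟩ := mem_writes_copyParams h; exact hx k hk h) S
  have hslot : ∀ k, S₁ (slot 0 k) = Store.ofList (F.params κ) k := fun k => by
    by_cases hk : k < 4
    · have := step_copyParams 0 0 S ⟨k, hk⟩
      rw [zero_add] at this
      exact this.trans (hS k hk)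
    · rw [hf₁ _ fun j hj => by unfold slot; omega, h0']
      exact (List.getD_eq_default _ _ (by simpa [GroupFamily.params] using hk)).symm
  have hlow₁ : ∀ x < 10, S₁ x = S x := fun x hx => hf₁ x fun k _ => (slot_ne hx).symm
  refine hH.coupled_seq_straight (R := fun (out : Store × Store) S' _ => S' 0 = out.1 0) (straight_copyParams 0 0)
    fun hH => ?_
  rw [← hS₁] at hH ⊢
  refine hH.coupled_seq (R' := fun (out : Store × Store) S' _ => S' 0 = out.1 0)
    (R := fun (st : Store) S' t => (∀ k, S' (slot 0 k) = st k) ∧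
      (∀ x, (∀ k, x ≠ slot 0 k) → S' x = S₁ x) ∧ t = s)
    (fun _ => coupled_setup hsetup (hS.mono hlow₁) hslot) ?_
  rintro st S₂ s ⟨hst₂, hf₂, rfl⟩ hH
  have hlow₂ : ∀ x < 10, S₂ x = S x := fun x hx => by
    rw [hf₂ _ fun k => (slot_ne hx).symm, hlow₁ _ hx]
  have ht : Function.Injective fun j : Fin n => slot 1 (4 + n + j) := fun j k h => by
    have := (slot_strictMono 1).injective h
    omega
  refine hH.coupled_seq (R' := fun (out : Store × Store) S' _ => S' 0 = out.1 0)
    (R := fun (d : Fin n → F.Exponent κ) S' t =>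
      (∀ j ∈ List.finRange n, S' (slot 1 (4 + n + j)) = (d j : ℕ)) ∧
      (∀ x, (∀ j ∈ List.finRange n, x ≠ slot 1 (4 + n + j)) → S' x = S₂ x) ∧ t = s)
    (fun h => coupled_rands O s _ ht (fun _ => slot_ne (by norm_num)) _ (List.nodup_finRange n) S₂
      ((hlow₂ 3 (by norm_num)).trans (hS 3 (by norm_num))) h) ?_
  rintro d S₃ s ⟨hd₃, hf₃, rfl⟩ hH
  have hlow₃ : ∀ x < 10, S₃ x = S x := fun x hx => by
    rw [hf₃ _ fun k _ => (slot_ne hx).symm, hlow₂ _ hx]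
  refine hH.coupled_seq (R' := fun (out : Store × Store) S' _ => S' 0 = out.1 0)
    (R := fun (m : F.Exponent κ) S' t =>
      S' = Function.update S₃ (slot 1 (4 + 2 * n + N + 1)) m ∧ t = s)
    (fun h => coupled_rand O s ((hlow₃ 3 (by norm_num)).trans (hS 3 (by norm_num))) _) ?_
  rintro m S₄ s ⟨hS₄, rfl⟩ hH
  have hf₄ : ∀ x, x ≠ slot 1 (4 + 2 * n + N + 1) → S₄ x = S₃ x := fun x hx => by
    rw [hS₄, Function.update_of_ne hx]
  have hlow₄ : ∀ x < 10, S₄ x = S x := fun x hx => by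
    rw [hf₄ _ (slot_ne hx).symm, hlow₃ _ hx]
  refine hH.coupled_seq_straight (R := fun (out : Store × Store) S' _ => S' 0 = out.1 0) (straight_view _)
    fun hH => ?_
  -- The ballot value ignores the coordinate `i` of `d`, so inserting `a` there does not change it.
  have hBV : ballotValue F i κ (st r) m x d z =
      ballotValue F i κ (st r) m x (Function.update d i a) z := by
    unfold ballotValue
    congr 1
    refine Finset.prod_congr rfl fun j _ => ?_
    split_ifs with hj
    · rfl
    · rw [Function.update_of_ne hj]
  obtain ⟨v₁, v₂, v₃⟩ := step_view (r := r) (d := Function.update d i a) (st := st) (s := m) (x := x)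
    (z := z) (S := S₄) (hS.mono hlow₄) (by rw [hlow₄ _ (by norm_num), h4, Function.update_self])
    (by rw [hlow₄ _ (by norm_num), h5]) (by rw [hlow₄ _ (by norm_num), h6])
    (fun j hj => by
      rw [hf₄ _ (by unfold slot; omega), hd₃ j (List.mem_finRange j), Function.update_of_ne hj])
    (fun k => by
      rw [hf₄ _ (by unfold slot; omega), hf₃ _ fun j _ => by unfold slot; omega, hst₂])
    (by rw [hS₄, Function.update_self])
    (fun k hk => by
      rw [hf₄ _ (by unfold slot; omega), hf₃ _ fun j _ => by unfold slot; omega,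
        hf₂ _ fun k' => by unfold slot; omega, hf₁ _ fun k' _ => by unfold slot; omega, h0'])
    (fun k => by
      rw [hf₄ _ (by unfold slot; omega), hf₃ _ fun j _ => by unfold slot; omega,
        hf₂ _ fun k' => by unfold slot; omega, hf₁ _ fun k' _ => by unfold slot; omega, h0'])
  obtain ⟨xs, hxs⟩ : ∃ xs, Election.view F i κ (Function.update d i a) st m x
      (ballotValue F i κ (st r) m x d z) N = κ :: xs := ⟨_, rfl⟩
  rw [← hBV] at v₂
  rw [hxs] at v₂ ⊢
  rw [← PMF.bind_pure (P.result _ _ _)]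
  refine hH.coupled_seq (R := fun (out : Store × Store) S' _ => S' (slot 1 0) = out.1 0)
    (R' := fun (out : Store × Store) S' _ => S' 0 = out.1 0)
    (fun _ => hU _ xs (fun k hk => (v₁ k hk).trans (hS.mono hlow₄ k hk)) v₂ v₃) ?_
  intro out S' t' hS' _
  rw [(runs_copy O S' t' (slot_ne (by norm_num)).symm).2]
  refine .pure ?_
  simpa using hS'

end Reduction

theorem List.exists_forall_lt_two_pow (l : List ℕ) : ∃ L, ∀ x ∈ l, x < 2 ^ L :=
  ⟨l.sum, fun _ hx => Nat.lt_two_pow_self.trans_le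
    (Nat.pow_le_pow_right (by norm_num) (List.le_sum_of_mem hx))⟩

namespace Reduction

open Prog

variable {σ : Type} {O : Peer σ} {F : GroupFamily} {κ n N : ℕ} {i : Fin n} {P setup : Prog}
  {S : Store} {s : σ} {ot : OTProtocol}

theorem exists_haltsWithin_receiverPeer (hP : P.PolyTime) (hot : ot.EfficientReceiver N)
    (κ κ' : ℕ) (xs ys : List ℕ) (r : Fin N) : ∃ T, P.HaltsWithin ot.receiverPeer
      (Store.ofList (κ :: xs)) (OTProtocol.receiverInit (κ' :: ys) r) T := by
  obtain ⟨T, hT⟩ := hP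
  obtain ⟨M, hM⟩ := hot.peerBounded
  obtain ⟨L, hL⟩ := xs.exists_forall_lt_two_pow
  obtain ⟨L', hL'⟩ := ys.exists_forall_lt_two_pow
  have hO := (hM κ' L' ys r hL').mono (Nat.le_add_left _ L)
  exact ⟨_, hT κ _ xs _ _ _ _ (fun x hx => (hL x hx).trans_le
    (Nat.pow_le_pow_right (by norm_num) (Nat.le_add_right _ _))) ⟨0, .init⟩ hO⟩

/-- With a genuine receiver as partner, the messages are passed on. The index `r₀` used for the
prepared view may differ from the receiver's choice `r`, because the local copy of the receiver's
registers is not consulted. -/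
theorem emulates_forward (hP : P.PolyTime) (hot : ot.EfficientReceiver N) (r : Fin N) (r₀ : ℕ) :
    Emulates F κ ot P (OTProtocol.receiverInit (F.params κ) r) ot.receiverPeer
      (OTProtocol.receiverInit (F.params κ) r) r₀
      (embedAt (slot 1) (forwardCall (slot 1)) P) := by
  intro S xs hS h1 _
  obtain ⟨T, hT⟩ := exists_haltsWithin_receiverPeer hP hot κ κ xs (F.params κ).tail r
  have hS0 : S 0 = κ := hS 0 (by norm_num)
  exact (simulates_embedAt (st := Store.ofList (κ :: xs)) (S := S)
    (R := fun out S' _ => S' (slot 1 0) = out.1 0) (slot_strictMono 1).injective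
    (slot_ne (by norm_num)) hS0.symm (fun k _ => h1 k)
    fun S' h _ => (hT.embed_forwardCall (slot_strictMono 1).injective h).mono le_rfl
      fun _ _ _ h => h 0).coupled

theorem emulates_inlineRun (hP : P.PolyTime) (hot : ot.EfficientReceiver N) (r : Fin N)
    (O : Peer σ) (s : σ) :
    Emulates F κ ot P (OTProtocol.receiverInit (F.params κ) r) O s r
      (inlineRun (slot 1) (slot 2) r ot.receiver P) := by
  intro S xs hS h1 h2
  obtain ⟨T, hT⟩ := exists_haltsWithin_receiverPeer hP hot κ κ xs (F.params κ).tail r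
  obtain ⟨T₀, M, hQ⟩ := hot.answers
  obtain ⟨L, hL⟩ := (F.params κ).tail.exists_forall_lt_two_pow
  have hS0 : S 0 = κ := hS 0 (by norm_num)
  have hne : ∀ j k, slot 1 j ≠ slot 2 k := fun j k => by unfold slot; omega
  exact ((simulates_inlineRun (O := O) (s := s) hT (slot_strictMono 1).injective
    (slot_strictMono 2).injective hne (fun k => slot_ne (by norm_num))
    (fun k => slot_ne (by norm_num)) (hQ κ L T _ r hL) .init hS0.symm (fun k _ => h1 k) rfl rfl
    hS0.symm fun k hk => h2 k (by omega)).mono le_rfl fun _ _ _ h => h 0).coupled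

/-! ### Distribution of the ballot -/

theorem coe_publicKey_update (d : Fin n → F.Exponent κ) (a : F.Exponent κ) :
    (Election.publicKey F κ (Function.update d i a) : ZMod (F.q κ)) =
      (F.g κ : ZMod (F.q κ)) ^ (a : ℕ) *
        ∏ j, (F.g κ : ZMod (F.q κ)) ^ (if j = i then 0 else (d j : ℕ)) := by
  rw [Election.publicKey, ← Finset.mul_prod_erase _ _ (Finset.mem_univ i),
    ← Finset.mul_prod_erase Finset.univ (fun j => (F.g κ : ZMod (F.q κ)) ^ _)
      (Finset.mem_univ i)]
  simp only [Function.update_self, Units.val_mul, Units.val_pow_eq_pow_val, if_true, pow_zero,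
    one_mul, Units.coe_prod]
  congr 1
  refine Finset.prod_congr rfl fun j hj => ?_
  have hj := (Finset.mem_erase.1 hj).1
  rw [Function.update_of_ne hj, if_neg hj]

/-- Splitting off voter `i` gives e^x = g^(ax) · ∏_{j≠i} (g^x)^(d_j), which is computable from g^x
once g^(ax) is given. -/
theorem ballotValue_eq_ballot (p s x : ℕ) (d : Fin n → F.Exponent κ) (a : F.Exponent κ) :
    ballotValue F i κ p s x d ((F.g κ : ZMod (F.q κ)) ^ ((a : ℕ) * x)) =
      Election.ballot F κ p s x (Election.publicKey F κ (Function.update d i a)) := by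
  rw [Election.ballot, coe_publicKey_update, ballotValue, mul_pow, ← Finset.prod_pow, ← pow_mul]
  simp only [← pow_mul, mul_comm x]
  ring

/-- Write `w` as a power g^k; multiplication by it shifts the exponent by k, which permutes the
residues modulo the order. -/
theorem map_uniform_mul {w : (ZMod (F.q κ))ˣ} (hw : w ∈ F.G κ) :
    ((PMF.uniformOfFintype (F.Exponent κ)).map fun c : F.Exponent κ => F.g κ ^ (c : ℕ) * w) =
      (PMF.uniformOfFintype (F.Exponent κ)).map fun c : F.Exponent κ => F.g κ ^ (c : ℕ) := by
  obtain ⟨k, hk⟩ := mem_zpowers_iff_mem_range_orderOf.1 hw |> Finset.mem_image.1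
  obtain ⟨hk, rfl⟩ := hk
  have hk := Finset.mem_range.1 hk
  let e := Equiv.addRight (⟨k, hk⟩ : F.Exponent κ)
  conv_rhs => rw [← PMF.map_uniformOfFintype_equiv e, PMF.map_comp]
  refine congrArg (fun f => PMF.map f _) (funext fun c => ?_)
  simp only [e, Function.comp_apply, Equiv.coe_addRight, Fin.val_add, pow_mod_orderOf, pow_add]

/-- This is where membership of the primes in G matters: all factors beside g^c then lie in G and
are absorbed by the uniform exponent. -/
theorem bind_ballotValue {α : Type} {p : ℕ} (hp : ∃ u ∈ F.G κ, (u : ZMod (F.q κ)) = p)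
    (s x : ℕ) (d : Fin n → F.Exponent κ) (f : ZMod (F.q κ) → PMF α) :
    ((PMF.uniformOfFintype (F.Exponent κ)).bind fun c =>
        f (ballotValue F i κ p s x d ((F.g κ : ZMod (F.q κ)) ^ (c : ℕ)))) =
      (PMF.uniformOfFintype (F.Exponent κ)).bind fun c =>
        f ((F.g κ ^ (c : ℕ) : (ZMod (F.q κ))ˣ) : ZMod (F.q κ)) := by
  obtain ⟨u, hu, hp⟩ := hp
  have hg : F.g κ ∈ F.G κ := Subgroup.mem_zpowers _
  have hw : u * F.g κ ^ s * ∏ j, (F.g κ ^ x) ^ (if j = i then 0 else (d j : ℕ)) ∈ F.G κ :=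
    mul_mem (mul_mem hu (pow_mem hg _)) (prod_mem fun j _ => pow_mem (pow_mem hg _) _)
  have := congrArg (fun μ => μ.bind fun v : (ZMod (F.q κ))ˣ => f v) (map_uniform_mul hw)
  simp only [PMF.bind_map] at this
  refine Eq.trans (congrArg _ (funext fun c => congrArg f ?_)) this
  simp only [ballotValue, ← hp, Units.val_mul, Units.val_pow_eq_pow_val,
    Units.coe_prod, mul_assoc]

theorem hasParams_append (l : List ℕ) : HasParams F κ (Store.ofList (F.params κ ++ l)) :=
  fun k hk => by rw [Store.ofList_append, if_pos (by simpa [GroupFamily.params] using hk)]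

end Reduction

theorem PMF.bind_comm₃ {α β γ δ ε : Type} (p : PMF α) (q : PMF β) (r : PMF γ) (s : PMF δ)
    (f : α → β → γ → δ → PMF ε) :
    (p.bind fun a => q.bind fun b => r.bind fun c => s.bind fun d => f a b c d) =
      r.bind fun c => q.bind fun b => s.bind fun d => p.bind fun a => f a b c d := by
  simp only [PMF.bind_comm p]
  rw [PMF.bind_comm q]

theorem Negligible.of_abs_sub {f g h : ℕ → ℝ} (h₁ : Negligible fun κ => |f κ - g κ|)
    (h₂ : Negligible fun κ => |g κ - h κ|) : Negligible fun κ => |f κ - h κ| :=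
  SuperpolynomialDecay.trans_abs_le (SuperpolynomialDecay.add h₁ h₂) fun κ => by
    simpa using (abs_sub_le (f κ) (g κ) (h κ)).trans (le_abs_self _)

/-! ### The adversary's output in the two experiments -/

namespace Reduction

open Prog

variable {σ : Type} {O : Peer σ} {F : GroupFamily} {κ n N : ℕ} {i : Fin n} {P setup U : Prog}
  {S : Store} {s : σ} {ot : OTProtocol}

/-- The output of the adversary `P` in the election, when voter `i` has the public key `g ^ a` and
publishes `(g ^ x, b)` with the ballot `b` that is determined by `z`, and the receiver has
choice `r'`. -/
noncomputable def output (F : GroupFamily) (ot : OTProtocol) (setup P : Prog) (i : Fin n)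
    (r r' : Fin N) (κ : ℕ) (a x : F.Exponent κ) (z : ZMod (F.q κ)) : PMF ℕ :=
  (setupResult F setup κ).bind fun st =>
    (PMF.uniformOfFintype (Fin n → F.Exponent κ)).bind fun d =>
    (PMF.uniformOfFintype (F.Exponent κ)).bind fun m =>
    (P.result ot.receiverPeer (Store.ofList (Election.view F i κ (Function.update d i a) st m x
      (ballotValue F i κ (st r) m x d z) N)) (OTProtocol.receiverInit (F.params κ) r')).map
      fun out => out.1 0

theorem map_result_reduction {r r' : Fin N} {a x : F.Exponent κ} {z : ZMod (F.q κ)}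
    (hsetup : setup.PolyTime) (hH : (reduction setup n N i r U).Halts O S s)
    (hU : Emulates F κ ot P (OTProtocol.receiverInit (F.params κ) r') O s r U)
    (hS : HasParams F κ S) (h4 : S 4 = F.power κ a) (h5 : S 5 = F.power κ x) (h6 : S 6 = z.val)
    (h0 : ∀ k, 10 ≤ k → S k = 0) :
    ((reduction setup n N i r U).result O S s).map (fun out => out.1 0) =
      output F ot setup P i r r' κ a x z := by
  rw [← (coupled_reduction hsetup hH hU hS h4 h5 h6 h0).map_eq (f := fun out => out.1 0)
    fun _ _ h => h.symm]
  simp only [output, PMF.map_bind]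

/-- The first exponent of the triple acts as the private key of voter `i` and the second as x_i.
After reordering the independent draws, resampling coordinate `i` merges `a` with the other keys
into one uniform family. -/
theorem bind_output_real {r : Fin N} :
    ((PMF.uniformOfFintype (F.Exponent κ)).bind fun a =>
      (PMF.uniformOfFintype (F.Exponent κ)).bind fun b =>
      output F ot setup P i r r κ a b ((F.g κ : ZMod (F.q κ)) ^ ((a : ℕ) * b))) =
    (Election.real F ot setup i r κ).input.bind fun l =>
      (P.result ot.receiverPeer (Store.ofList l) (OTProtocol.receiverInit (F.params κ) r)).map
        fun out => out.1 0 := by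
  have : (Election.real F ot setup i r κ).input =
    (PMF.uniformOfFintype (Fin n → F.Exponent κ)).bind fun d =>
    (setupResult F setup κ).bind fun st => (PMF.uniformOfFintype (F.Exponent κ)).bind fun s =>
    (PMF.uniformOfFintype (F.Exponent κ)).bind fun x => PMF.pure
      (Election.view F i κ d st s x (Election.ballot F κ (st r) s x
        (Election.publicKey F κ d)) N) := rfl
  rw [this]
  simp only [PMF.bind_bind, PMF.pure_bind, output, ballotValue_eq_ballot]
  simp only [PMF.bind_comm₃ (PMF.uniformOfFintype (F.Exponent κ)) (setupResult F setup κ)]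
  rw [PMF.bind_uniformOfFintype_update (α := F.Exponent κ) i (fun d =>
    (setupResult F setup κ).bind fun st => (PMF.uniformOfFintype (F.Exponent κ)).bind fun s =>
    (PMF.uniformOfFintype (F.Exponent κ)).bind fun x => (P.result ot.receiverPeer (Store.ofList
      (Election.view F i κ d st s x (Election.ballot F κ (st r) s x
        (Election.publicKey F κ d)) N)) (OTProtocol.receiverInit (F.params κ) r)).map
        fun out => out.1 0)]

/-- The index `r` of the prime disappears, since the ballot is uniform whichever prime enters; only
the receiver's choice `r'` survives. This lets one attack serve against both choices. -/
theorem bind_output_random {r r' : Fin N} (hsetup : AdmissibleSetup F n N setup) :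
    ((PMF.uniformOfFintype (F.Exponent κ)).bind fun a =>
      (PMF.uniformOfFintype (F.Exponent κ)).bind fun b =>
      (PMF.uniformOfFintype (F.Exponent κ)).bind fun c =>
      output F ot setup P i r r' κ a b ((F.g κ : ZMod (F.q κ)) ^ (c : ℕ))) =
    (Election.random F ot setup i r' κ).input.bind fun l =>
      (P.result ot.receiverPeer (Store.ofList l) (OTProtocol.receiverInit (F.params κ) r')).map
        fun out => out.1 0 := by
  have : (Election.random F ot setup i r' κ).input =
    (PMF.uniformOfFintype (Fin n → F.Exponent κ)).bind fun d =>
    (setupResult F setup κ).bind fun st => (PMF.uniformOfFintype (F.Exponent κ)).bind fun s =>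
    (PMF.uniformOfFintype (F.Exponent κ)).bind fun x =>
    (PMF.uniformOfFintype (F.Exponent κ)).bind fun u => PMF.pure
      (Election.view F i κ d st s x ((F.g κ ^ (u : ℕ) : (ZMod (F.q κ))ˣ) : ZMod (F.q κ)) N) := rfl
  rw [this]
  simp only [PMF.bind_bind, PMF.pure_bind, output]
  simp only [PMF.bind_comm₃ (PMF.uniformOfFintype (F.Exponent κ)) (setupResult F setup κ)]
  simp only [PMF.bind_comm₃ (PMF.uniformOfFintype (F.Exponent κ))
    (PMF.uniformOfFintype (Fin n → F.Exponent κ)) (setupResult F setup κ)]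
  simp only [PMF.bind_comm (setupResult F setup κ)
    (PMF.uniformOfFintype (Fin n → F.Exponent κ))]
  rw [← PMF.bind_uniformOfFintype_update (α := F.Exponent κ) i]
  -- Admissibility is known only for outcomes in the support of the setup, hence the congruence
  -- restricted to the support.
  refine congrArg _ (funext fun a => congrArg _ (funext fun d =>
    PMF.bind_congr_support fun st hst => congrArg _ (funext fun m => congrArg _ (funext fun b => ?_))))
  exact bind_ballotValue ((hsetup.2 κ st hst).mem r) m b d fun z => (P.result ot.receiverPeer
    (Store.ofList (Election.view F i κ (Function.update d i a) st m b z N))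
      (OTProtocol.receiverInit (F.params κ) r')).map fun out => out.1 0

/-! ### The two hybrid steps -/

theorem notMem_writes_inlineRun (r : ℕ) (Q P : Prog) :
    0 ∉ (inlineRun (slot 1) (slot 2) r Q P).writes := by
  have hs : ∀ c k, 0 ≠ slot c k := fun c k => (slot_ne (by norm_num)).symm
  have hQ := notMem_writes_embed (ρ := slot 2) (f := noCall (slot 2)) (x := 0)
    (fun k => (hs 2 k).symm) (fun d a => by simp [noCall, writes, hs]) Q
  have hP := notMem_writes_embed (ρ := slot 1) (f := inlineCall (slot 1) (slot 2) Q) (x := 0)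
    (fun k => (hs 1 k).symm) (fun d a => by simp [inlineCall, writes, hs, hQ]) P
  simp [inlineRun, embedAt, writes, hs, hP]

theorem notMem_writes_forward (P : Prog) :
    0 ∉ (embedAt (slot 1) (forwardCall (slot 1)) P).writes := by
  have hs : ∀ c k, 0 ≠ slot c k := fun c k => (slot_ne (by norm_num)).symm
  have hP := notMem_writes_embed (ρ := slot 1) (f := forwardCall (slot 1)) (x := 0)
    (fun k => (hs 1 k).symm) (fun d a => by simp [forwardCall, writes, hs]) P
  simp [embedAt, writes, hs, hP]

theorem exists_haltsWithin_noPeer {R : Prog} (hR : R.PolyTime) (κ : ℕ)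
    (xs : List ℕ) : R.Halts noPeer (Store.ofList (κ :: xs)) () := by
  obtain ⟨T, hT⟩ := hR
  obtain ⟨L, hL⟩ := xs.exists_forall_lt_two_pow
  exact ⟨_, hT κ L xs Unit noPeer () (fun _ => True) hL trivial (by simp [noPeer])⟩

theorem indistinguishable_real_random (hot : ot.EfficientReceiver N) (hDH : F.DiffieHellman)
    (hsetup : AdmissibleSetup F n N setup) (i : Fin n) (r : Fin N) :
    Indistinguishable (Election.real F ot setup i r) (Election.random F ot setup i r) := by
  intro P hP
  set U := inlineRun (slot 1) (slot 2) r ot.receiver P with hU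
  set D := reduction setup n N i r U with hD
  have hne : ∀ j k, slot 1 j ≠ slot 2 k := fun j k => by unfold slot; omega
  have hDpoly : D.PolyTime := (efficient_reduction hsetup.1 (efficient_inlineRun
    (slot_strictMono 1) (slot_strictMono 2) hne (fun k => slot_ne (by norm_num))
    (fun k => slot_ne (by norm_num)) hP hot r) (notMem_writes_inlineRun _ _ _) r).polyTime
  -- The triple follows the four parameters and so occupies registers `4`, `5`, `6`, where the
  -- reduction expects it. The exponent `c` is arbitrary, so both kinds of triple are covered.
  have hrun : ∀ κ (a b : F.Exponent κ) (c : ℕ),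
      (D.result noPeer (Store.ofList (F.params κ ++ [F.power κ a, F.power κ b, F.power κ c]))
        ()).map (fun out => out.1 0) =
      output F ot setup P i r r κ a b ((F.g κ : ZMod (F.q κ)) ^ c) := by
    intro κ a b c
    exact map_result_reduction hsetup.1 (exists_haltsWithin_noPeer hDpoly κ _)
      (emulates_inlineRun hP hot r _ _) (hasParams_append _) rfl rfl (power_eq F κ c)
      fun k hk => List.getD_eq_default _ _ (by simp [GroupFamily.params]; omega)
  refine (hDH D hDpoly).congr fun κ => ?_
  have h₁ : (F.ddhReal κ).prob D = (Election.real F ot setup i r κ).prob P := by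
    have : (F.ddhReal κ).input = (PMF.uniformOfFintype (F.Exponent κ)).bind fun a =>
      (PMF.uniformOfFintype (F.Exponent κ)).bind fun b => PMF.pure
      (F.params κ ++ [F.power κ a, F.power κ b, F.power κ (a * b : ℕ)]) := rfl
    unfold Experiment.prob
    rw [this]
    simp only [PMF.bind_bind, PMF.pure_bind]
    refine congrArg (fun μ : PMF ℕ => (μ 1).toReal) (Eq.trans ?_ bind_output_real)
    exact congrArg _ (funext fun a => congrArg _ (funext fun b => hrun κ a b _))
  have h₂ : (F.ddhRandom κ).prob D = (Election.random F ot setup i r κ).prob P := by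
    have : (F.ddhRandom κ).input = (PMF.uniformOfFintype (F.Exponent κ)).bind fun a =>
      (PMF.uniformOfFintype (F.Exponent κ)).bind fun b =>
      (PMF.uniformOfFintype (F.Exponent κ)).bind fun c => PMF.pure
      (F.params κ ++ [F.power κ a, F.power κ b, F.power κ c]) := rfl
    unfold Experiment.prob
    rw [this]
    simp only [PMF.bind_bind, PMF.pure_bind]
    refine congrArg (fun μ : PMF ℕ => (μ 1).toReal)
      (Eq.trans ?_ (bind_output_random (r := r) hsetup))
    exact congrArg _ (funext fun a => congrArg _ (funext fun b => congrArg _ (funext fun c =>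
      hrun κ a b c)))
  rw [h₁, h₂]

/-- Write a random element of the group into register `d`. -/
def randPower (d : ℕ) : Prog := (rand d 3).seq (powMod d 2 d 1)

theorem efficient_randPower {d : ℕ} (hd : d ≠ 0) : (randPower d).Efficient :=
  (efficient_rand d 3).seq (by simpa [writes] using hd.symm) (efficient_powMod _ _ _ _)

theorem coupled_randPower {d : ℕ} (hS : HasParams F κ S) (hd : 4 ≤ d)
    (hH : (randPower d).Halts O S s) :
    PMF.Coupled (fun (a : F.Exponent κ) out =>
        out.1 = Function.update S d (F.power κ a) ∧ out.2 = s)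
      (PMF.uniformOfFintype (F.Exponent κ)) ((randPower d).result O S s) := by
  rw [← PMF.bind_pure (PMF.uniformOfFintype _)]
  refine hH.coupled_seq (R := fun (a : F.Exponent κ) S' t => S' = Function.update S d a ∧ t = s)
    (R' := fun (a : F.Exponent κ) S' t => S' = Function.update S d (F.power κ a) ∧ t = s)
    (fun _ => coupled_rand O s (hS 3 (by norm_num)) d) ?_
  rintro a _ _ ⟨rfl, rfl⟩ -
  rw [(runs_powMod _ _ _ _ _ _ _).2]
  refine .pure ⟨?_, rfl⟩
  have h1 : S 1 = F.q κ := hS 1 (by norm_num)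
  have h2 : S 2 = (F.g κ : ZMod (F.q κ)).val := hS 2 (by norm_num)
  simp only [Function.update_self, Function.update_idem,
    Function.update_of_ne (show 1 ≠ d by omega), Function.update_of_ne (show 2 ≠ d by omega), h1, h2,
    powModVal_val, power_eq]

/-- The malicious sender that attacks the oblivious transfer by means of the adversary `P`. -/
def attack (setup : Prog) (n N : ℕ) (i : Fin n) (r : ℕ) (P : Prog) : Prog :=
  (randPower 4).seq ((randPower 5).seq ((randPower 6).seq
    (reduction setup n N i r (embedAt (slot 1) (forwardCall (slot 1)) P))))

theorem polyTime_attack (hsetup : setup.PolyTime) (hP : P.PolyTime) (r : ℕ) :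
    (attack setup n N i r P).PolyTime := by
  have h0 : ∀ d, d ≠ 0 → 0 ∉ (randPower d).writes := fun d hd => by
    simpa [randPower, writes] using hd.symm
  exact ((efficient_randPower (by norm_num)).seq (h0 _ (by norm_num))
    ((efficient_randPower (by norm_num)).seq (h0 _ (by norm_num))
    ((efficient_randPower (by norm_num)).seq (h0 _ (by norm_num))
    (efficient_reduction hsetup (efficient_embedAt_forwardCall (slot_strictMono 1)
      (by simp [slot]) hP) (notMem_writes_forward P) r)))).polyTime

/-- The attack draws three independent exponents, so its view is exactly that of the random
experiment. It always uses the index `r` for the prime and never needs to know the receiver's choice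
`r'`. -/
theorem prob_session_attack (hot : ot.EfficientReceiver N) (hsetup : AdmissibleSetup F n N setup)
    (hP : P.PolyTime) (r r' : Fin N) (κ : ℕ) :
    (ot.session F r' κ).prob (attack setup n N i r P) =
      (Election.random F ot setup i r' κ).prob P := by
  have hH : (attack setup n N i r P).Halts ot.receiverPeer (Store.ofList (F.params κ))
      (OTProtocol.receiverInit (F.params κ) r') :=
    exists_haltsWithin_receiverPeer (polyTime_attack hsetup.1 hP r) hot κ κ (F.params κ).tail
      (F.params κ).tail r'
  have hS : HasParams F κ (Store.ofList (F.params κ)) := fun _ _ => rfl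
  set S := Store.ofList (F.params κ) with hSdef
  have upd : ∀ {S : Store} {d : ℕ} (v : ℕ), 4 ≤ d → HasParams F κ S →
      HasParams F κ (Function.update S d v) := fun v hd hS k hk => by
    rw [Function.update_of_ne (by omega), hS k hk]
  have key : PMF.Coupled (fun y out => out.1 0 = y)
      ((PMF.uniformOfFintype (F.Exponent κ)).bind fun a =>
        (PMF.uniformOfFintype (F.Exponent κ)).bind fun b =>
        (PMF.uniformOfFintype (F.Exponent κ)).bind fun c =>
        output F ot setup P i r r' κ a b ((F.g κ : ZMod (F.q κ)) ^ (c : ℕ)))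
      ((attack setup n N i r P).result ot.receiverPeer S
        (OTProtocol.receiverInit (F.params κ) r')) := by
    refine hH.coupled_seq (R' := fun y S' _ => S' 0 = y) (R := fun (a : F.Exponent κ) S' t =>
      S' = Function.update S 4 (F.power κ a) ∧ t = OTProtocol.receiverInit (F.params κ) r')
      (fun h => coupled_randPower hS le_rfl h) ?_
    rintro a _ _ ⟨rfl, rfl⟩ hH
    refine hH.coupled_seq (R' := fun y S' _ => S' 0 = y) (R := fun (b : F.Exponent κ) S' t =>
      S' = Function.update (Function.update S 4 (F.power κ a)) 5 (F.power κ b) ∧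
        t = OTProtocol.receiverInit (F.params κ) r')
      (fun h => coupled_randPower (upd _ le_rfl hS) (by norm_num) h) ?_
    rintro b _ _ ⟨rfl, rfl⟩ hH
    refine hH.coupled_seq (R' := fun y S' _ => S' 0 = y) (R := fun (c : F.Exponent κ) S' t =>
      S' = Function.update (Function.update (Function.update S 4 (F.power κ a)) 5 (F.power κ b)) 6
        (F.power κ c) ∧ t = OTProtocol.receiverInit (F.params κ) r')
      (fun h => coupled_randPower (upd _ (by norm_num) (upd _ le_rfl hS)) (by norm_num) h) ?_
    rintro c _ _ ⟨rfl, rfl⟩ hH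
    rw [← map_result_reduction (z := (F.g κ : ZMod (F.q κ)) ^ (c : ℕ)) hsetup.1 hH
      (emulates_forward hP hot r' r) (upd _ (by norm_num) (upd _ (by norm_num) (upd _ le_rfl hS)))
      (by simp) (by simp) (by simp [power_eq]) fun k hk => by
        rw [Function.update_of_ne (by omega), Function.update_of_ne (by omega),
          Function.update_of_ne (by omega)]
        exact List.getD_eq_default _ _ (by simp [GroupFamily.params]; omega)]
    exact PMF.Coupled.map_left _ _
  have key := key.map_eq (f := id) (g := fun out : Store × Store => out.1 0)
    fun _ _ h => h.symm
  rw [PMF.map_id, bind_output_random hsetup] at key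
  have : (ot.session F r' κ).input = PMF.pure (F.params κ) := rfl
  unfold Experiment.prob
  rw [this, PMF.pure_bind]
  exact congrArg (fun μ : PMF ℕ => (μ 1).toReal) key.symm

theorem indistinguishable_random_random (hot : ot.EfficientReceiver N)
    (hRec : ot.ReceiverSecure F N) (hsetup : AdmissibleSetup F n N setup) (i : Fin n)
    (r r' : Fin N) :
    Indistinguishable (Election.random F ot setup i r) (Election.random F ot setup i r') := by
  intro P hP
  -- The same attack, built with the index `r`, is used for both choices. Receiver security is
  -- stated only for ordered pairs, whence the trichotomy and the symmetry of the absolute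
  -- difference.
  simp only [← prob_session_attack hot hsetup hP r]
  have hA := polyTime_attack (n := n) (N := N) (i := i) hsetup.1 hP r
  rcases lt_trichotomy r r' with h | rfl | h
  · exact hRec r r' h _ hA
  · simp only [sub_self, abs_zero]
    exact superpolynomialDecay_zero _ _
  · simp only [abs_sub_comm ((ot.session F r _).prob _)]
    exact hRec r' r h _ hA

end Reduction

theorem theorem1 (F : GroupFamily) (n m lam : ℕ) (ot : OTProtocol) (setup : Prog)
    (hOT : ot.IsOT F (lam * m)) (hRec : ot.ReceiverSecure F (lam * m))
    (hDH : F.DiffieHellman) (hsetup : AdmissibleSetup F n (lam * m) setup)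
    (i : Fin n) (r r' : Fin (lam * m)) :
    Indistinguishable (Election.real F ot setup i r) (Election.random F ot setup i r') :=
  fun P hP => Negligible.of_abs_sub
    (Reduction.indistinguishable_real_random hOT.receiver hDH hsetup i r P hP)
    (Reduction.indistinguishable_random_random hOT.receiver hRec hsetup i r r' P hP)
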